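/- All graphs $G=(V,E)$ are finite and simple. A graph "contains no $C_k$" if it has no (not necessarily induced) subgraph isomorphic to the cycle on $k$ vertices. For $w:V\to\mathbb{R}$ and $S\subseteq V$ put $w(S)=\sum_{s\in S}w(s)$; $G$ is $w$-well-covered if all its maximal independent sets have the same weight. The set $\mathrm{WCW}(G)$ of all $w:V\to\mathbb{R}$ for which $G$ is $w$-well-covered is a linear subspace of $\mathbb{R}^V$. An induced complete bipartite subgraph $B$ of $G$ with (non-empty) sides $B_X,B_Y$ is generating if there is an independent set $S$ of $G$ such that $S\cup B_X$ and $S\cup B_Y$ are both maximal independent sets of $G$. For $v\in V$ let $L_v$ be the linear space of all $w:V\to\mathbb{R}$ with $w(B_X)=w(B_Y)$ for every generating $B$ with $B_X=\{v\}$. Theorem. For every graph $G=(V,E)$ that contains neither $C_4$ nor $C_5$ nor $C_6$ nor $C_7$, one has $\mathrm{WCW}(G)=\bigcap_{v\in V}L_v$, and $\mathrm{WCW}(G)$ can be computed in polynomial time. More precisely, there is a program for the random access machine (integer memory cells, indirect addressing, comparison and the operations $+,-,\cdot$ and integer division, each at unit cost) which, given $n=|V|$ and the adjacency matrix of any such graph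 $G$ with vertex set $V=\{0,\dots,n-1\}$, halts after $O(|V|^3(|V|+|E|)+1)$ steps and outputs a basis, consisting of integer vectors, of the space $\mathrm{WCW}(G)$, and all integers that arise during the computation have a binary length bounded by a polynomial in $n$. -/

import Mathlib

namespace WWC

section Graphs

variable {V : Type*}

/-- `S` is a maximal (with respect to inclusion) independent set of `G`. -/
def IsMaxIndep (G : SimpleGraph V) (S : Finset V) : Prop :=
  Maximal (fun T : Finset V => G.IsIndepSet (T : Set V)) S

/-- `G` is `w`-well-covered: all maximal independent sets have the same weight. -/
def IsWellCovered (G : SimpleGraph V) (w : V → ℝ) : Prop :=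
  ∀ S T : Finset V, IsMaxIndep G S → IsMaxIndep G T → ∑ v ∈ S, w v = ∑ v ∈ T, w v

/-- The vector space of the weight functions `w` for which `G` is `w`-well-covered. -/
def wellCoveredSpace (G : SimpleGraph V) : Submodule ℝ (V → ℝ) where
  carrier := {w | IsWellCovered G w}
  zero_mem' := by intro S T _ _; simp
  add_mem' := by
    intro a b ha hb S T hS hT
    simp [Finset.sum_add_distrib, ha S T hS hT, hb S T hS hT]
  smul_mem' := by
    intro c a ha S T hS hT
    simp [← Finset.mul_sum, ha S T hS hT]

/-- The subgraph of `G` induced by `X ∪ Y` is complete bipartite with (non-empty) sides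
`X` and `Y`. -/
def IsInducedBiclique (G : SimpleGraph V) (X Y : Finset V) : Prop :=
  X.Nonempty ∧ Y.Nonempty ∧ G.IsIndepSet (X : Set V) ∧ G.IsIndepSet (Y : Set V) ∧
    ∀ x ∈ X, ∀ y ∈ Y, G.Adj x y

/-- The induced complete bipartite subgraph of `G` with sides `X` and `Y` is generating. -/
def IsGenerating [DecidableEq V] (G : SimpleGraph V) (X Y : Finset V) : Prop :=
  IsInducedBiclique G X Y ∧
    ∃ S : Finset V, G.IsIndepSet (S : Set V) ∧ IsMaxIndep G (S ∪ X) ∧ IsMaxIndep G (S ∪ Y)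

/-- The space `L_v` of the weight functions that satisfy the constraint `w(B_X) = w(B_Y)` of every
generating subgraph `B` of `G` with `B_X = {v}`. -/
def starSpace [DecidableEq V] (G : SimpleGraph V) (v : V) : Submodule ℝ (V → ℝ) where
  carrier := {w | ∀ Y : Finset V, IsGenerating G {v} Y → ∑ x ∈ {v}, w x = ∑ y ∈ Y, w y}
  zero_mem' := by intro Y _; simp
  add_mem' := by
    intro a b ha hb Y hY
    simpa [Finset.sum_add_distrib] using congrArg₂ (· + ·) (ha Y hY) (hb Y hY)
  smul_mem' := by
    intro c a ha Y hY
    simpa [← Finset.mul_sum] using congrArg (c * ·) (ha Y hY)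

/-- `G` has no (not necessarily induced) subgraph isomorphic to a cycle of length
4, 5, 6 or 7. -/
def NoC4567 (G : SimpleGraph V) : Prop :=
  ∀ k ∈ ({4, 5, 6, 7} : Finset ℕ), (SimpleGraph.cycleGraph k).Free G

end Graphs

/-! A random access machine in structured form.  Its memory consists of integer arrays with two
integer indices; the array names occurring in a program are constants, while the indices may be
computed.  A scalar variable is a cell with constant indices. -/

/-- The memory: `s a i j` is the content of the cell `(i, j)` of the array `a`. -/
abbrev Mem : Type := ℕ → ℤ → ℤ → ℤ

/-- Expressions: constants, array cells, and the arithmetic operations. -/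
inductive Exp : Type
  | const (c : ℤ)
  | cell (a : ℕ) (i j : Exp)
  | add (e f : Exp)
  | sub (e f : Exp)
  | mul (e f : Exp)
  | div (e f : Exp)

namespace Exp

/-- The value of an expression; `div` is integer division, with `x / 0 = 0`. -/
def val (s : Mem) : Exp → ℤ
  | const c => c
  | cell a i j => s a (i.val s) (j.val s)
  | add e f => e.val s + f.val s
  | sub e f => e.val s - f.val s
  | mul e f => e.val s * f.val s
  | div e f => e.val s / f.val s

/-- The number of elementary steps used to evaluate an expression: one for each constant, each
memory access and each arithmetic operation. -/
def time : Exp → ℕ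
  | const _ => 1
  | cell _ i j => i.time + j.time + 1
  | add e f => e.time + f.time + 1
  | sub e f => e.time + f.time + 1
  | mul e f => e.time + f.time + 1
  | div e f => e.time + f.time + 1

/-- The largest binary length of the values (addresses included) of the subexpressions. -/
def bits (s : Mem) : Exp → ℕ
  | const c => c.natAbs.size
  | cell a i j => max (max (i.bits s) (j.bits s)) ((cell a i j).val s).natAbs.size
  | add e f => max (max (e.bits s) (f.bits s)) ((add e f).val s).natAbs.size
  | sub e f => max (max (e.bits s) (f.bits s)) ((sub e f).val s).natAbs.size
  | mul e f => max (max (e.bits s) (f.bits s)) ((mul e f).val s).natAbs.size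
  | div e f => max (max (e.bits s) (f.bits s)) ((div e f).val s).natAbs.size

end Exp

/-- Programs. -/
inductive Prog : Type
  /-- do nothing -/
  | skip
  /-- store the value of `e` in the cell `(i, j)` of the array `a` -/
  | write (a : ℕ) (i j e : Exp)
  /-- run `p`, then `q` -/
  | seq (p q : Prog)
  /-- if `e` is positive, run `p`, otherwise run `q` -/
  | branch (e : Exp) (p q : Prog)
  /-- as long as `e` is positive, run `p` -/
  | loop (e : Exp) (p : Prog)

/-- The memory `s` after `x` has been stored in the cell `(i, j)` of the array `a`. -/
def Mem.store (s : Mem) (a : ℕ) (i j x : ℤ) : Mem :=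
  fun a' i' j' => if a' = a ∧ i' = i ∧ j' = j then x else s a' i' j'

/-- `Run p s t b s'`: started on the memory `s`, the program `p` halts with the memory `s'` after
`t` elementary steps, and `b` is the largest binary length of a number that arises on the way
(as a value, an intermediate result or an address). -/
inductive Run : Prog → Mem → ℕ → ℕ → Mem → Prop
  | skip (s : Mem) : Run .skip s 1 0 s
  | write (s : Mem) (a : ℕ) (i j e : Exp) :
      Run (.write a i j e) s (i.time + j.time + e.time + 1)
        (max (max (i.bits s) (j.bits s)) (e.bits s))
        (s.store a (i.val s) (j.val s) (e.val s))
  | seq {p q : Prog} {s s₁ s₂ : Mem} {t₁ t₂ b₁ b₂ : ℕ}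
      (hp : Run p s t₁ b₁ s₁) (hq : Run q s₁ t₂ b₂ s₂) :
      Run (.seq p q) s (t₁ + t₂) (max b₁ b₂) s₂
  | branch_pos {e : Exp} {p q : Prog} {s s₁ : Mem} {t b : ℕ}
      (he : 0 < e.val s) (hp : Run p s t b s₁) :
      Run (.branch e p q) s (e.time + 1 + t) (max (e.bits s) b) s₁
  | branch_neg {e : Exp} {p q : Prog} {s s₁ : Mem} {t b : ℕ}
      (he : ¬ 0 < e.val s) (hq : Run q s t b s₁) :
      Run (.branch e p q) s (e.time + 1 + t) (max (e.bits s) b) s₁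
  | loop_pos {e : Exp} {p : Prog} {s s₁ s₂ : Mem} {t₁ t₂ b₁ b₂ : ℕ}
      (he : 0 < e.val s) (hp : Run p s t₁ b₁ s₁) (hl : Run (.loop e p) s₁ t₂ b₂ s₂) :
      Run (.loop e p) s (e.time + 1 + (t₁ + t₂)) (max (e.bits s) (max b₁ b₂)) s₂
  | loop_neg {e : Exp} {p : Prog} {s : Mem} (he : ¬ 0 < e.val s) :
      Run (.loop e p) s (e.time + 1) (e.bits s) s

open Classical in
/-- The input memory for a graph with the vertices `0, …, n - 1`: the number `n` is in the cell
`(0, 0)` of the array `0`, the adjacency matrix is in the array `1`, and all other cells are `0`. -/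
noncomputable def inputMem {n : ℕ} (G : SimpleGraph (Fin n)) : Mem := fun a i j =>
  if a = 0 ∧ i = 0 ∧ j = 0 then (n : ℤ)
  else if a = 1 ∧ ∃ u v : Fin n, i = (u : ℤ) ∧ j = (v : ℤ) ∧ G.Adj u v then 1
  else 0

/-- The memory `s` holds a basis of the subspace `L` of `ℝⁿ`: the cell `(0, 0)` of the array `2`
holds the number `d` of basis vectors, and for `i < d` the coordinates of the `i`-th basis vector
are in the cells `(i, 0), …, (i, n - 1)` of the array `3`. -/
def HoldsBasis {n : ℕ} (s : Mem) (L : Submodule ℝ (Fin n → ℝ)) : Prop :=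
  ∃ d : ℕ, s 2 0 0 = (d : ℤ) ∧
    LinearIndependent ℝ (fun (i : Fin d) (v : Fin n) => (s 3 (i : ℤ) (v : ℤ) : ℝ)) ∧
    Submodule.span ℝ
      (Set.range (fun (i : Fin d) (v : Fin n) => (s 3 (i : ℤ) (v : ℤ) : ℝ))) = L

end WWC

namespace WWC

/-! ### Generating subgraphs and the exchange argument -/

section Graphs

variable {V : Type*}

/-! The constraints of generating subgraphs determine the space. If two maximal independent sets
`S`, `T` are such that `S \ T` and `T \ S` are completely joined, these differences form a
generating subgraph. Otherwise a non-adjacent pair, one vertex from each difference, extends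
together with `S ∩ T` to a maximal independent set that shares more with `S` and with `T` than they
share with each other, and induction applies (`isWellCovered_of_generating`). Without `C₄`, a
complete bipartite subgraph has a side with one vertex, so the stars suffice.

For the algorithm, generating stars are recognised locally (`isGenerating_singleton_iff`). A set `Y`
of neighbours of `v` is the leaf set of one exactly if it is non-empty and independent, each `u ∈ Y`
passes a test on its second neighbourhood (`Allowed`), and `Y` dominates the neighbours of `v` that
nothing outside of `N[v]` can dominate (`Forced`). The independent set completing the star is
assembled from individually chosen witnesses; an edge between two witnesses would close a cycle of
length 5, 6 or 7.

Since there is no `C₄`, `N(v)` induces a matching and isolated vertices. Hence all leaf sets at `v`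
arise from a canonical one by swapping matched vertices and deleting unforced ones, and at most `n`
equations with coefficients in `{-1, 0, 1}` describe all constraints at `v`
(`mem_wellCoveredSpace_iff_row`).

The resulting `n²` equations are solved by fraction-free elimination. A matrix `M`, initially the
identity, has its rows replaced by independent equations; the columns of its adjugate with no pivot
form an integral basis of the solutions. One replacement is a rank-one update of the adjugate in
`O(n²)` operations with exact divisions, and all stored entries are determinants of matrices with
entries in `{-1, 0, 1}`, hence at most `n!`. The total is `O(n⁴)`, which is within `O(n³(n + |E|))`.
-/

theorem isContained_cycleGraph_of_adj {G : SimpleGraph V} {m : ℕ} (f : Fin (m + 2) → V)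
    (hf : Function.Injective f) (h : ∀ i, G.Adj (f i) (f (i + 1))) :
    (SimpleGraph.cycleGraph (m + 2)).IsContained G := by
  refine ⟨⟨⟨f, ?_⟩, hf⟩⟩
  intro a b hab
  rw [SimpleGraph.cycleGraph_adj] at hab
  rcases hab with hab | hab
  · obtain rfl : a = b + 1 := by rw [← hab]; abel
    exact (h b).symm
  · obtain rfl : b = a + 1 := by rw [← hab]; abel
    exact h a

theorem NoC4567.no_cycle {G : SimpleGraph V} (hG : NoC4567 G) {m : ℕ} (hm : 2 ≤ m) (hm' : m ≤ 5)
    (f : Fin (m + 2) → V) (h : ∀ i, G.Adj (f i) (f (i + 1))) (hf : f.Injective) : False := by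
  refine hG (m + 2) ?_ (isContained_cycleGraph_of_adj f hf h)
  interval_cases m <;> simp

theorem NoC4567.no_c4 {G : SimpleGraph V} (hG : NoC4567 G) {a b c d : V} (hab : G.Adj a b)
    (hbc : G.Adj b c) (hcd : G.Adj c d) (hda : G.Adj d a) (hac : a ≠ c) (hbd : b ≠ d) : False := by
  refine hG.no_cycle le_rfl (by norm_num) ![a, b, c, d] ?_ ?_
  · intro i; fin_cases i <;> assumption
  · have := hab.ne; have := hbc.ne; have := hcd.ne; have := hda.ne
    intro i j; fin_cases i <;> fin_cases j <;> simp <;> grind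

theorem NoC4567.no_c5 {G : SimpleGraph V} (hG : NoC4567 G) {a b c d e : V} (hab : G.Adj a b)
    (hbc : G.Adj b c) (hcd : G.Adj c d) (hde : G.Adj d e) (hea : G.Adj e a)
    (hac : a ≠ c) (had : a ≠ d) (hbd : b ≠ d) (hbe : b ≠ e) (hce : c ≠ e) : False := by
  refine hG.no_cycle (m := 3) (by norm_num) (by norm_num) ![a, b, c, d, e] ?_ ?_
  · intro i; fin_cases i <;> assumption
  · have := hab.ne; have := hbc.ne; have := hcd.ne; have := hde.ne; have := hea.ne
    intro i j; fin_cases i <;> fin_cases j <;> simp <;> grind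

theorem NoC4567.no_c6 {G : SimpleGraph V} (hG : NoC4567 G) {a b c d e f : V} (hab : G.Adj a b)
    (hbc : G.Adj b c) (hcd : G.Adj c d) (hde : G.Adj d e) (hef : G.Adj e f) (hfa : G.Adj f a)
    (hac : a ≠ c) (had : a ≠ d) (hae : a ≠ e) (hbd : b ≠ d) (hbe : b ≠ e) (hbf : b ≠ f)
    (hce : c ≠ e) (hcf : c ≠ f) (hdf : d ≠ f) : False := by
  refine hG.no_cycle (m := 4) (by norm_num) (by norm_num) ![a, b, c, d, e, f] ?_ ?_
  · intro i; fin_cases i <;> assumption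
  · have := hab.ne; have := hbc.ne; have := hcd.ne; have := hde.ne; have := hef.ne
    have := hfa.ne
    intro i j; fin_cases i <;> fin_cases j <;> simp <;> grind

theorem NoC4567.no_c7 {G : SimpleGraph V} (hG : NoC4567 G) {a b c d e f g : V} (hab : G.Adj a b)
    (hbc : G.Adj b c) (hcd : G.Adj c d) (hde : G.Adj d e) (hef : G.Adj e f) (hfg : G.Adj f g)
    (hga : G.Adj g a) (hac : a ≠ c) (had : a ≠ d) (hae : a ≠ e) (haf : a ≠ f) (hbd : b ≠ d)
    (hbe : b ≠ e) (hbf : b ≠ f) (hbg : b ≠ g) (hce : c ≠ e) (hcf : c ≠ f) (hcg : c ≠ g)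
    (hdf : d ≠ f) (hdg : d ≠ g) (heg : e ≠ g) : False := by
  refine hG.no_cycle (m := 5) (by norm_num) (by norm_num) ![a, b, c, d, e, f, g] ?_ ?_
  · intro i; fin_cases i <;> assumption
  · have := hab.ne; have := hbc.ne; have := hcd.ne; have := hde.ne; have := hef.ne
    have := hfg.ne; have := hga.ne
    intro i j; fin_cases i <;> fin_cases j <;> simp <;> grind

theorem isMaxIndep_iff {G : SimpleGraph V} {S : Finset V} :
    IsMaxIndep G S ↔ G.IsIndepSet (S : Set V) ∧ ∀ z, z ∉ S → ∃ y ∈ S, G.Adj z y := by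
  classical
  constructor
  · intro h
    refine ⟨h.prop, fun z hz => ?_⟩
    by_contra! hc
    have : G.IsIndepSet ((insert z S : Finset V) : Set V) := by
      rw [Finset.coe_insert]
      exact Set.Pairwise.insert h.prop fun b hb _ => ⟨hc b hb, fun h => hc b hb h.symm⟩
    exact hz (h.le_of_ge this (Finset.subset_insert z S) (Finset.mem_insert_self z S))
  · rintro ⟨h, h'⟩
    refine ⟨h, fun T hT hST z hz => ?_⟩
    by_contra hzS
    obtain ⟨y, hy, hzy⟩ := h' z hzS
    exact hT (Finset.mem_coe.2 hz) (Finset.mem_coe.2 (hST hy)) hzy.ne hzy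

theorem exists_isMaxIndep_superset [Finite V] {G : SimpleGraph V} {S : Finset V}
    (hS : G.IsIndepSet (S : Set V)) : ∃ T, S ⊆ T ∧ IsMaxIndep G T := by
  have := Fintype.ofFinite V
  obtain ⟨T, hT, hT'⟩ := (Set.toFinite {T : Finset V | G.IsIndepSet (T : Set V)}).exists_le_maximal
    (show S ∈ {T : Finset V | G.IsIndepSet (T : Set V)} from hS)
  exact ⟨T, hT, hT'⟩

variable [DecidableEq V]

/-- The common part `S` is disjoint from both sides, as every vertex of one side has a neighbour in
the other; so its weight cancels. -/
theorem IsGenerating.sum_eq {G : SimpleGraph V} {X Y : Finset V} (h : IsGenerating G X Y)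
    {w : V → ℝ} (hw : IsWellCovered G w) : ∑ x ∈ X, w x = ∑ y ∈ Y, w y := by
  obtain ⟨⟨⟨x, hx⟩, ⟨y, hy⟩, -, -, hXY⟩, S, -, hSX, hSY⟩ := h
  have key := hw _ _ hSX hSY
  rw [Finset.sum_union, Finset.sum_union] at key
  · linarith
  · rw [Finset.disjoint_left]
    intro a ha ha'
    exact hSX.prop (by simp [ha]) (by simp [hx]) (hXY x hx a ha').ne.symm (hXY x hx a ha').symm
  · rw [Finset.disjoint_left]
    intro a ha ha'
    exact hSY.prop (by simp [ha]) (by simp [hy]) (hXY a ha' y hy).ne (hXY a ha' y hy)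

/-- A weight function that satisfies the constraints of all generating subgraphs is constant on
maximal independent sets. -/
theorem isWellCovered_of_generating [Fintype V] {G : SimpleGraph V} {w : V → ℝ}
    (h : ∀ X Y, IsGenerating G X Y → ∑ x ∈ X, w x = ∑ y ∈ Y, w y) : IsWellCovered G w := by
  suffices H : ∀ m : ℕ, ∀ S T : Finset V, IsMaxIndep G S → IsMaxIndep G T →
      Fintype.card V - (S ∩ T).card = m → ∑ v ∈ S, w v = ∑ v ∈ T, w v from
    fun S T hS hT => H _ S T hS hT rfl
  intro m
  induction m using Nat.strong_induction_on with
  | _ m ih =>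
  intro S T hS hT hm
  by_cases hST : S ⊆ T
  · rw [(hST.antisymm (hS.le_of_ge hT.prop hST))]
  by_cases hTS : T ⊆ S
  · rw [(hTS.antisymm (hT.le_of_ge hS.prop hTS))]
  by_cases hB : ∀ x ∈ S \ T, ∀ y ∈ T \ S, G.Adj x y
  · have hg : IsGenerating G (S \ T) (T \ S) := by
      refine ⟨⟨by simpa [Finset.sdiff_nonempty], by simpa [Finset.sdiff_nonempty],
        hS.prop.mono (by simp), hT.prop.mono (by simp), hB⟩, S ∩ T, hS.prop.mono (by simp), ?_, ?_⟩
      · rwa [show S ∩ T ∪ S \ T = S by grind]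
      · rwa [show S ∩ T ∪ T \ S = T by grind]
    have := h _ _ hg
    rw [← Finset.sum_sdiff (Finset.inter_subset_left (s₁ := S) (s₂ := T)),
      ← Finset.sum_sdiff (Finset.inter_subset_right (s₁ := S) (s₂ := T)),
      Finset.sdiff_inter_self_left,
      Finset.sdiff_inter_self_right, this]
  · push Not at hB
    obtain ⟨x, hx, y, hy, hxy⟩ := hB
    rw [Finset.mem_sdiff] at hx hy
    -- Any maximal `U` containing this set meets `S` also in `x` and `T` also in `y`, so both pairs
    -- `S, U` and `U, T` are closer than `S, T`.
    have hi : G.IsIndepSet ((insert x (insert y (S ∩ T)) : Finset V) : Set V) := by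
      intro a ha b hb hab h'
      simp only [Finset.coe_insert, Finset.coe_inter, Set.mem_insert_iff, Set.mem_inter_iff,
        Finset.mem_coe] at ha hb
      have hSi : ∀ a ∈ S, ∀ b ∈ S, ¬ G.Adj a b := fun a ha b hb h => hS.prop ha hb h.ne h
      have hTi : ∀ a ∈ T, ∀ b ∈ T, ¬ G.Adj a b := fun a ha b hb h => hT.prop ha hb h.ne h
      have := h'.symm
      grind
    obtain ⟨U, hU, hUm⟩ := exists_isMaxIndep_superset hi
    have h1 : (S ∩ T).card < (S ∩ U).card := by
      apply Finset.card_lt_card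
      rw [Finset.ssubset_iff_of_subset]
      · exact ⟨x, by simp [hx.1, hU (Finset.mem_insert_self x _)], by simp [hx.2]⟩
      · intro a ha
        have : a ∈ U := hU (by simp only [Finset.mem_insert]; tauto)
        grind
    have h2 : (S ∩ T).card < (U ∩ T).card := by
      apply Finset.card_lt_card
      rw [Finset.ssubset_iff_of_subset]
      · exact ⟨y, by simp [hy.1, hU (Finset.mem_insert_of_mem (Finset.mem_insert_self y _))],
          by simp [hy.2]⟩
      · intro a ha
        have : a ∈ U := hU (by simp only [Finset.mem_insert]; tauto)
        grind
    have h3 := Finset.card_le_univ (S ∩ U)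
    have h4 := Finset.card_le_univ (U ∩ T)
    exact (ih _ (by omega) S U hS hUm rfl).trans (ih _ (by omega) U T hUm hT rfl)

theorem wellCoveredSpace_eq_iInf_starSpace [Fintype V] {G : SimpleGraph V} (hG : NoC4567 G) :
    wellCoveredSpace G = ⨅ v : V, starSpace G v := by
  apply le_antisymm
  · refine le_iInf fun v w hw Y hY => hY.sum_eq hw
  · intro w hw
    rw [Submodule.mem_iInf] at hw
    refine isWellCovered_of_generating fun X Y hXY => ?_
    rcases (Nat.succ_le_of_lt hXY.1.1.card_pos).eq_or_lt with hX | hX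
    · obtain ⟨x, rfl⟩ := Finset.card_eq_one.1 hX.symm
      exact hw x Y hXY
    rcases (Nat.succ_le_of_lt hXY.1.2.1.card_pos).eq_or_lt with hY | hY
    · obtain ⟨y, rfl⟩ := Finset.card_eq_one.1 hY.symm
      refine (hw y X ⟨⟨hXY.1.2.1, hXY.1.1, hXY.1.2.2.2.1, hXY.1.2.2.1,
        fun a ha b hb => (hXY.1.2.2.2.2 b hb a ha).symm⟩, ?_⟩).symm
      obtain ⟨S, h1, h2, h3⟩ := hXY.2
      exact ⟨S, h1, h3, h2⟩
    -- Two vertices on each side span a 4-cycle.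
    · obtain ⟨a, ha, c, hc, hac⟩ := Finset.one_lt_card.1 hX
      obtain ⟨b, hb, d, hd, hbd⟩ := Finset.one_lt_card.1 hY
      have h := hXY.1.2.2.2.2
      exact (hG.no_c4 (h a ha b hb) (h c hc b hb).symm (h c hc d hd) (h a ha d hd).symm
        hac hbd).elim

end Graphs

/-! ### Local characterisation of generating stars -/

section Stars

variable {V : Type*}

/-- The neighbour `u` of `v` may lie in a generating star with the centre `v`: every vertex of
`N(u) \ N[v]` has a neighbour outside of `N[u]`. -/
def Allowed (G : SimpleGraph V) (v u : V) : Prop :=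
  G.Adj v u ∧ ∀ x, G.Adj u x → x ≠ v → ¬ G.Adj v x → ∃ y, G.Adj x y ∧ y ≠ u ∧ ¬ G.Adj u y

/-- All neighbours of the neighbour `u` of `v` are in `N[v]`. -/
def Forced (G : SimpleGraph V) (v u : V) : Prop :=
  G.Adj v u ∧ ∀ x, G.Adj u x → x = v ∨ G.Adj v x

theorem Forced.allowed {G : SimpleGraph V} {v u : V} (h : Forced G v u) : Allowed G v u :=
  ⟨h.1, fun x hx hxv hvx => by rcases h.2 x hx with h | h <;> contradiction⟩

/-- A leaf set of a generating star with the centre `v`, described by local conditions. -/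
structure IsLeafSet (G : SimpleGraph V) (v : V) (Y : Finset V) : Prop where
  nonempty : Y.Nonempty
  indep : ∀ u ∈ Y, ∀ u' ∈ Y, ¬ G.Adj u u'
  allowed : ∀ u ∈ Y, Allowed G v u
  forced : ∀ u, Forced G v u → u ∈ Y ∨ ∃ y ∈ Y, G.Adj u y

variable [DecidableEq V]

/-- A vertex of `N(u) \ N[v]` must be dominated by `S`, and `S` has no vertex in `N[u]`. A forced
vertex has no neighbour in `S`, because its neighbours lie in `N[v]`, which `S` avoids; so `Y` has
to dominate it. -/
theorem IsGenerating.isLeafSet {G : SimpleGraph V} {v : V} {Y : Finset V}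
    (h : IsGenerating G {v} Y) : IsLeafSet G v Y := by
  obtain ⟨⟨-, hY, -, hYi, hvY⟩, S, -, hSv, hSY⟩ := h
  rw [isMaxIndep_iff] at hSv hSY
  have hSvi : ∀ a ∈ S ∪ {v}, ∀ b ∈ S ∪ {v}, ¬ G.Adj a b :=
    fun a ha b hb h => hSv.1 (Finset.mem_coe.2 ha) (Finset.mem_coe.2 hb) h.ne h
  have hSYi : ∀ a ∈ S ∪ Y, ∀ b ∈ S ∪ Y, ¬ G.Adj a b :=
    fun a ha b hb h => hSY.1 (Finset.mem_coe.2 ha) (Finset.mem_coe.2 hb) h.ne h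
  have hvY' : ∀ y ∈ Y, G.Adj v y := fun y hy => hvY v (by simp) y hy
  refine ⟨hY, fun a ha b hb => hSYi a (by simp [ha]) b (by simp [hb]),
    fun u hu => ⟨hvY' u hu, fun x hux hxv hvx => ?_⟩, fun u hu => ?_⟩
  · have hxS : x ∉ S ∪ {v} := by
      intro hx
      simp only [Finset.mem_union, Finset.mem_singleton, hxv, or_false] at hx
      exact hSYi u (by simp [hu]) x (by simp [hx]) hux
    obtain ⟨y, hy, hxy⟩ := hSv.2 x hxS
    have hyv : y ≠ v := by rintro rfl; exact hvx hxy.symm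
    simp only [Finset.mem_union, Finset.mem_singleton, hyv, or_false] at hy
    refine ⟨y, hxy, ?_, hSYi u (by simp [hu]) y (by simp [hy])⟩
    rintro rfl
    exact hSvi v (by simp) y (by simp [hy]) (hvY' y hu)
  · by_cases huY : u ∈ Y
    · exact Or.inl huY
    right
    have huS : u ∉ S := fun h => hSvi v (by simp) u (by simp [h]) hu.1
    obtain ⟨y, hy, huy⟩ := hSY.2 u (by simp [huS, huY])
    rcases Finset.mem_union.1 hy with hy | hy
    · exfalso
      rcases hu.2 y huy with rfl | h
      · obtain ⟨z, hz⟩ := hY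
        exact hSYi y (by simp [hy]) z (by simp [hz]) (hvY' z hz)
      · exact hSvi v (by simp) y (by simp [hy]) h
    · exact ⟨y, hy, huy⟩

/-- Extension of an independent set to a set that is maximal among the independent sets avoiding
a given set. -/
theorem exists_maximal_indep_avoiding [Finite V] {G : SimpleGraph V} {P : V → Prop} {S : Finset V}
    (hS : ∀ a ∈ S, ∀ b ∈ S, ¬ G.Adj a b) (hP : ∀ a ∈ S, P a) :
    ∃ T, S ⊆ T ∧ (∀ a ∈ T, ∀ b ∈ T, ¬ G.Adj a b) ∧ (∀ a ∈ T, P a) ∧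
      ∀ z, P z → z ∉ T → ∃ y ∈ T, G.Adj z y := by
  have := Fintype.ofFinite V
  obtain ⟨T, hT, hT'⟩ := (Set.toFinite {T : Finset V | (∀ a ∈ T, ∀ b ∈ T, ¬ G.Adj a b) ∧
    ∀ a ∈ T, P a}).exists_le_maximal (show S ∈ _ from ⟨hS, hP⟩)
  refine ⟨T, hT, hT'.prop.1, hT'.prop.2, fun z hz hzT => ?_⟩
  by_contra! hc
  refine hzT (hT'.le_of_ge (y := insert z T) ⟨?_, ?_⟩ (Finset.subset_insert z T)
    (Finset.mem_insert_self z T))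
  · have h1 := hT'.prop.1
    intro a ha b hb
    rcases Finset.mem_insert.1 ha with rfl | ha' <;> rcases Finset.mem_insert.1 hb with rfl | hb'
    · exact G.irrefl
    · exact hc b hb'
    · exact fun h => hc a ha' h.symm
    · exact h1 a ha' b hb'
  · have h1 := hT'.prop.2
    intro a ha
    rcases Finset.mem_insert.1 ha with rfl | ha
    · exact hz
    · exact h1 a ha

/-- `S` has to dominate `N(Y) \ N[v]` and `N(v) \ N[Y]` while avoiding `N[v]` and `N(Y)`. `Allowed`
provides witnesses for the former, non-forcedness for the latter. The forbidden cycles make the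
witnesses legal and pairwise non-adjacent, and the remaining vertices are handled by extending to a
maximal set. -/
theorem IsLeafSet.isGenerating [Fintype V] {G : SimpleGraph V} (hG : NoC4567 G) {v : V}
    {Y : Finset V} (h : IsLeafSet G v Y) : IsGenerating G {v} Y := by
  classical
  obtain ⟨hne, hind, hall, hfor⟩ := h
  -- the set of the vertices that dominate `N(Y) \ N[v]`, and of those that dominate `N(v) \ N[Y]`
  let Q : V → V → V → Prop := fun u x y =>
    u ∈ Y ∧ G.Adj u x ∧ x ≠ v ∧ ¬ G.Adj v x ∧ G.Adj x y ∧ y ≠ u ∧ ¬ G.Adj u y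
  let R : V → V → Prop := fun u x =>
    G.Adj v u ∧ u ∉ Y ∧ (∀ y ∈ Y, ¬ G.Adj u y) ∧ G.Adj u x ∧ x ≠ v ∧ ¬ G.Adj v x
  -- One witness is fixed for each `x`, not for each pair `(u, x)`: distinct witnesses then belong
  -- to distinct `x`, as `hQQ` requires.
  have hf1 : ∃ f : V → V, ∀ x, (∃ u y, Q u x y) → ∃ u, Q u x (f x) := by
    refine Classical.axiomOfChoice (r := fun x z => (∃ u y, Q u x y) → ∃ u, Q u x z) fun x => ?_
    by_cases hx : ∃ u y, Q u x y
    · obtain ⟨u, y, h⟩ := hx; exact ⟨y, fun _ => ⟨u, h⟩⟩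
    · exact ⟨x, fun h => (hx h).elim⟩
  have hf2 : ∃ f : V → V, ∀ u, (∃ x, R u x) → R u (f u) := by
    refine Classical.axiomOfChoice (r := fun u z => (∃ x, R u x) → R u z) fun u => ?_
    by_cases hx : ∃ x, R u x
    · obtain ⟨x, h⟩ := hx; exact ⟨x, fun _ => h⟩
    · exact ⟨u, fun h => (hx h).elim⟩
  obtain ⟨f, hf⟩ := hf1
  obtain ⟨g, hg⟩ := hf2
  let S0 : Finset V := Finset.univ.filter fun z =>
    (∃ u x, Q u x z ∧ f x = z) ∨ ∃ u, R u z ∧ g u = z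
  have hvY : ∀ u ∈ Y, G.Adj v u := fun u hu => (hall u hu).1
  have hQv : ∀ u x y, Q u x y → y ≠ v ∧ ¬ G.Adj v y := by
    rintro u x y ⟨h1, h2, h3, h4, h5, h6, h7⟩
    refine ⟨?_, fun h => ?_⟩
    · rintro rfl; exact h4 h5.symm
    · exact hG.no_c4 (hvY u h1) h2 h5 h.symm h3.symm h6.symm
  have hQY : ∀ u x y, Q u x y → ∀ z ∈ Y, ¬ G.Adj z y := by
    rintro u x y hQ z hz hzy
    obtain ⟨hy1, hy2⟩ := hQv u x y hQ
    obtain ⟨h1, h2, h3, h4, h5, h6, h7⟩ := hQ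
    have hzu : u ≠ z := by rintro rfl; exact h7 hzy
    refine hG.no_c5 (hvY u h1) h2 h5 hzy.symm (hvY z hz).symm h3.symm hy1.symm h6.symm hzu ?_
    rintro rfl
    exact h4 (hvY x hz)
  have hRY : ∀ u x, R u x → ∀ z ∈ Y, ¬ G.Adj z x := by
    rintro u x ⟨h1, h2, h3, h4, h5, h6⟩ z hz hzx
    have hzu : u ≠ z := by rintro rfl; exact h2 hz
    exact hG.no_c4 h1 h4 hzx.symm (hvY z hz).symm h5.symm hzu
  -- The edge `y₁y₂` closes the 5-cycle `u x₁ y₁ y₂ x₂` if `u₁ = u₂ = u`, and the 7-cycle `v u₁ x₁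
  -- y₁ y₂ x₂ u₂` otherwise.
  have hQQ : ∀ u₁ x₁ y₁ u₂ x₂ y₂, Q u₁ x₁ y₁ → Q u₂ x₂ y₂ → x₁ ≠ x₂ → ¬ G.Adj y₁ y₂ := by
    rintro u₁ x₁ y₁ u₂ x₂ y₂ hQ₁ hQ₂ hx hy
    obtain ⟨ha1, ha2⟩ := hQv _ _ _ hQ₁
    obtain ⟨hb1, hb2⟩ := hQv _ _ _ hQ₂
    have hc1 := hQY _ _ _ hQ₁
    have hc2 := hQY _ _ _ hQ₂
    obtain ⟨h1, h2, h3, h4, h5, h6, h7⟩ := hQ₁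
    obtain ⟨k1, k2, k3, k4, k5, k6, k7⟩ := hQ₂
    have e1 : y₁ ≠ x₂ := by rintro rfl; exact hc1 _ k1 k2
    have e2 : x₁ ≠ y₂ := by rintro rfl; exact hc2 _ h1 h2
    by_cases hu : u₁ = u₂
    · subst hu
      exact hG.no_c5 h2 h5 hy k5.symm k2.symm h6.symm k6.symm e2 hx e1
    · have i1 : ∀ z, ¬ G.Adj v z → ∀ u ∈ Y, u ≠ z := by
        rintro z hz u hu rfl; exact hz (hvY u hu)
      exact hG.no_c7 (hvY _ h1) h2 h5 hy k5.symm k2.symm (hvY _ k1).symm h3.symm ha1.symm hb1.symm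
        k3.symm h6.symm (i1 _ hb2 _ h1) (i1 _ k4 _ h1) hu e2 hx (i1 _ h4 _ k1).symm e1
        (i1 _ ha2 _ k1).symm k6
  -- Here the cycle is `v u₁ x₁ y₁ x₂ u₂`; for two witnesses of the second kind it is `v u₁ x₁ x₂
  -- u₂`.
  have hQR : ∀ u₁ x₁ y₁ u₂ x₂, Q u₁ x₁ y₁ → R u₂ x₂ → ¬ G.Adj y₁ x₂ := by
    rintro u₁ x₁ y₁ u₂ x₂ hQ hR hy
    obtain ⟨ha1, ha2⟩ := hQv _ _ _ hQ
    have hc := hRY _ _ hR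
    obtain ⟨h1, h2, h3, h4, h5, h6, h7⟩ := hQ
    obtain ⟨k1, k2, k3, k4, k5, k6⟩ := hR
    have hx : x₁ ≠ x₂ := by rintro rfl; exact hc _ h1 h2
    have hu : u₁ ≠ u₂ := by rintro rfl; exact k2 h1
    have i1 : ∀ z, ¬ G.Adj v z → u₁ ≠ z ∧ u₂ ≠ z := by
      rintro z hz; constructor <;> rintro rfl <;> exact hz (by first | exact k1 | exact hvY _ h1)
    exact hG.no_c6 (hvY _ h1) h2 h5 hy k4.symm k1.symm h3.symm ha1.symm k5.symm h6.symm
      (i1 _ k6).1 hu hx (i1 _ h4).2.symm (i1 _ ha2).2.symm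
  have hRR : ∀ u₁ x₁ u₂ x₂, R u₁ x₁ → R u₂ x₂ → u₁ ≠ u₂ → ¬ G.Adj x₁ x₂ := by
    rintro u₁ x₁ u₂ x₂ ⟨h1, h2, h3, h4, h5, h6⟩ ⟨k1, k2, k3, k4, k5, k6⟩ hu hx
    have i1 : ∀ z, ¬ G.Adj v z → u₁ ≠ z ∧ u₂ ≠ z := by
      rintro z hz; constructor <;> rintro rfl <;> exact hz (by assumption)
    exact hG.no_c5 h1 h4 hx k4.symm k1.symm h5.symm k5.symm (i1 _ k6).1 hu (i1 _ h6).2.symm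
  have hS0i : ∀ a ∈ S0, ∀ b ∈ S0, ¬ G.Adj a b := by
    intro a ha b hb hab
    simp only [S0, Finset.mem_filter, Finset.mem_univ, true_and] at ha hb
    rcases ha with ⟨u, x, ha, rfl⟩ | ⟨u, ha, rfl⟩ <;>
      rcases hb with ⟨u', x', hb, rfl⟩ | ⟨u', hb, rfl⟩
    · by_cases hx : x = x'
      · subst hx; exact hab.ne rfl
      · exact hQQ _ _ _ _ _ _ ha hb hx hab
    · exact hQR _ _ _ _ _ ha hb hab
    · exact hQR _ _ _ _ _ hb ha hab.symm
    · by_cases hu : u = u'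
      · subst hu; exact hab.ne rfl
      · exact hRR _ _ _ _ ha hb hu hab
  obtain ⟨S, hS0, hSi, hSP, hSm⟩ := exists_maximal_indep_avoiding
    (P := fun z => z ≠ v ∧ ¬ G.Adj v z ∧ ∀ u ∈ Y, ¬ G.Adj u z) hS0i (by
      intro a ha
      simp only [S0, Finset.mem_filter, Finset.mem_univ, true_and] at ha
      rcases ha with ⟨u, x, ha, rfl⟩ | ⟨u, ha, rfl⟩
      · exact ⟨(hQv _ _ _ ha).1, (hQv _ _ _ ha).2, hQY _ _ _ ha⟩
      · exact ⟨ha.2.2.2.2.1, ha.2.2.2.2.2, hRY _ _ ha⟩)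
  have hdom : ∀ z, z ≠ v → ¬ G.Adj v z → z ∉ S → ∃ y ∈ S, G.Adj z y := by
    intro z hzv hvz hzS
    by_cases hz : ∃ u ∈ Y, G.Adj u z
    · obtain ⟨u, hu, huz⟩ := hz
      obtain ⟨y, hy⟩ := (hall u hu).2 z huz hzv hvz
      obtain ⟨u', hu'⟩ := hf z ⟨u, y, hu, huz, hzv, hvz, hy⟩
      refine ⟨f z, hS0 ?_, hu'.2.2.2.2.1⟩
      simp only [S0, Finset.mem_filter, Finset.mem_univ, true_and]
      exact Or.inl ⟨u', z, hu', rfl⟩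
    · push Not at hz
      exact hSm z ⟨hzv, hvz, hz⟩ hzS
  refine ⟨⟨⟨v, by simp⟩, hne, by simp, fun a ha b hb _ => hind a ha b hb,
    fun x hx y hy => by rw [Finset.mem_singleton.1 hx]; exact hvY y hy⟩, S,
    fun a ha b hb _ => hSi a ha b hb, ?_, ?_⟩
  · refine isMaxIndep_iff.2 ⟨?_, fun z hz => ?_⟩
    · rintro a ha b hb - hab
      simp only [Finset.coe_union, Finset.coe_singleton, Set.mem_union, Finset.mem_coe,
        Set.mem_singleton_iff] at ha hb
      rcases ha with ha | rfl <;> rcases hb with hb | rfl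
      · exact hSi a ha b hb hab
      · exact (hSP a ha).2.1 hab.symm
      · exact (hSP b hb).2.1 hab
      · exact hab.ne rfl
    · simp only [Finset.mem_union, Finset.mem_singleton, not_or] at hz
      by_cases hvz : G.Adj v z
      · exact ⟨v, by simp, hvz.symm⟩
      obtain ⟨y, hy, h⟩ := hdom z hz.2 hvz hz.1
      exact ⟨y, by simp [hy], h⟩
  · refine isMaxIndep_iff.2 ⟨?_, fun z hz => ?_⟩
    · rintro a ha b hb - hab
      simp only [Finset.coe_union, Set.mem_union, Finset.mem_coe] at ha hb
      rcases ha with ha | ha <;> rcases hb with hb | hb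
      · exact hSi a ha b hb hab
      · exact (hSP a ha).2.2 b hb hab.symm
      · exact (hSP b hb).2.2 a ha hab
      · exact hind a ha b hb hab
    · simp only [Finset.mem_union, not_or] at hz
      by_cases hzv : z = v
      · obtain ⟨y, hy⟩ := hne
        exact ⟨y, by simp [hy], hzv ▸ hvY y hy⟩
      by_cases hvz : G.Adj v z
      · by_cases hzY : ∃ y ∈ Y, G.Adj z y
        · obtain ⟨y, hy, h⟩ := hzY; exact ⟨y, by simp [hy], h⟩
        have hzf : ¬ Forced G v z := fun h => by
          rcases hfor z h with h | h
          · exact hz.2 h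
          · exact hzY h
        simp only [Forced, hvz, true_and, not_forall, not_or] at hzf
        obtain ⟨x, hx, hxv, hvx⟩ := hzf
        push Not at hzY
        have hR := hg z ⟨x, hvz, hz.2, hzY, hx, hxv, hvx⟩
        refine ⟨g z, Finset.mem_union_left _ (hS0 ?_), hR.2.2.2.1⟩
        simp only [S0, Finset.mem_filter, Finset.mem_univ, true_and]
        exact Or.inr ⟨z, hR, rfl⟩
      · obtain ⟨y, hy, h⟩ := hdom z hzv hvz hz.1
        exact ⟨y, by simp [hy], h⟩

theorem isGenerating_singleton_iff [Fintype V] {G : SimpleGraph V} (hG : NoC4567 G) {v : V}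
    {Y : Finset V} : IsGenerating G {v} Y ↔ IsLeafSet G v Y :=
  ⟨IsGenerating.isLeafSet, IsLeafSet.isGenerating hG⟩

end Stars

/-! ### A finite system of equations for the star constraints -/

section Rows

variable {V : Type*} [LinearOrder V]

/-- The order in which the leaves of stars with the centre `v` are chosen: forced vertices first. -/
def Precedes (G : SimpleGraph V) (v x u : V) : Prop :=
  (Forced G v x ∧ ¬ Forced G v u) ∨ ((Forced G v x ↔ Forced G v u) ∧ x < u)

/-- Membership in the canonical leaf set for the centre `v`. -/
def Leaf (G : SimpleGraph V) (v u : V) : Prop :=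
  Allowed G v u ∧ ∀ x, Allowed G v x → G.Adj u x → Precedes G v u x

/-- Otherwise `v x u y` is a 4-cycle. Thus the edges inside `N(v)` form a matching. -/
theorem NoC4567.adj_unique {G : SimpleGraph V} (hG : NoC4567 G) {v u x y : V} (hu : G.Adj v u)
    (hx : G.Adj v x) (hy : G.Adj v y) (hux : G.Adj u x) (huy : G.Adj u y) : x = y := by
  by_contra h
  exact hG.no_c4 hx hux.symm huy hy.symm hu.ne h

theorem Precedes.asymm {G : SimpleGraph V} {v x u : V} (h : Precedes G v x u) :
    ¬ Precedes G v u x := by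
  rintro h'
  rcases h with h | h <;> rcases h' with h' | h'
  · exact h.2 h'.1
  · exact h.2 (h'.1.2 h.1)
  · exact h'.2 (h.1.2 h'.1)
  · exact lt_asymm h.2 h'.2

theorem precedes_or {G : SimpleGraph V} {v x u : V} (h : x ≠ u) :
    Precedes G v x u ∨ Precedes G v u x := by
  unfold Precedes
  rcases lt_or_gt_of_ne h with h | h <;> tauto

theorem Leaf.not_adj {G : SimpleGraph V} {v x u : V} (hx : Leaf G v x) (hu : Leaf G v u) :
    ¬ G.Adj x u :=
  fun h => (hx.2 u hu.1 h).asymm (hu.2 x hx.1 h.symm)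

/-- Some allowed neighbour `x` of `u` takes precedence over `u`. As `u` is the only neighbour of `x`
in `N(v)`, nothing else prevents `x` from being a leaf. -/
theorem Allowed.exists_leaf {G : SimpleGraph V} (hG : NoC4567 G) {v u : V} (hu : Allowed G v u)
    (hu' : ¬ Leaf G v u) : ∃ x, Leaf G v x ∧ G.Adj u x := by
  have : ∃ x, Allowed G v x ∧ G.Adj u x ∧ ¬ Precedes G v u x := by
    by_contra! h; exact hu' ⟨hu, h⟩
  obtain ⟨x, hx, hux, h⟩ := this
  refine ⟨x, ⟨hx, fun y hy hxy => ?_⟩, hux⟩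
  rw [hG.adj_unique hx.1 hy.1 hu.1 hxy hux.symm]
  exact (precedes_or hux.ne).resolve_left h

variable [Fintype V]

open Classical in
/-- The canonical leaf set for the centre `v`. -/
noncomputable def leaves (G : SimpleGraph V) (v : V) : Finset V := Finset.univ.filter (Leaf G v)

theorem mem_leaves {G : SimpleGraph V} {v u : V} : u ∈ leaves G v ↔ Leaf G v u := by
  simp [leaves]

open Classical in
/-- Integer coefficients of linear equations, indexed by pairs of vertices, that define the
space of the weight functions with well-covered graph. -/
noncomputable def row (G : SimpleGraph V) (v u x : V) : ℤ :=
  if u = v then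
    if (leaves G v).Nonempty then (if x = v then 1 else 0) - (if x ∈ leaves G v then 1 else 0)
      else 0
  else if u ∈ leaves G v then
    if ¬ Forced G v u ∧ 2 ≤ (leaves G v).card then (if x = u then 1 else 0) else 0
  else if Allowed G v u then
    (if x = u then 1 else 0) - (if x ∈ leaves G v ∧ G.Adj u x then 1 else 0)
  else 0

theorem abs_row_le (G : SimpleGraph V) (v u x : V) : |row G v u x| ≤ 1 := by
  unfold row; split_ifs <;> simp

theorem isLeafSet_leaves {G : SimpleGraph V} (hG : NoC4567 G) {v : V} (h : (leaves G v).Nonempty) :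
    IsLeafSet G v (leaves G v) where
  nonempty := h
  indep u hu u' hu' := (mem_leaves.1 hu).not_adj (mem_leaves.1 hu')
  allowed u hu := (mem_leaves.1 hu).1
  forced u hu := by
    by_cases h : Leaf G v u
    · exact Or.inl (mem_leaves.2 h)
    · obtain ⟨x, hx, hux⟩ := hu.allowed.exists_leaf hG h
      exact Or.inr ⟨x, mem_leaves.2 hx, hux⟩

/-- The matched vertices `u` and `x` dominate each other, and neither has a further neighbour in
`N(v)`; so the exchange leaves the dominated part of `N(v)` unchanged. -/
theorem isLeafSet_swap {G : SimpleGraph V} (hG : NoC4567 G) {v u x : V} (hu : Allowed G v u)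
    (hx : Leaf G v x) (hux : G.Adj u x) :
    IsLeafSet G v (insert u ((leaves G v).erase x)) := by
  have hI := isLeafSet_leaves hG ⟨x, mem_leaves.2 hx⟩
  refine ⟨by simp, ?_, ?_, ?_⟩
  · have h1 : ∀ y ∈ (leaves G v).erase x, ¬ G.Adj u y := by
      intro y hy huy
      rw [Finset.mem_erase] at hy
      exact hy.1 (hG.adj_unique hu.1 (hI.allowed y hy.2).1 hx.1.1 huy hux)
    intro a ha b hb
    rcases Finset.mem_insert.1 ha with rfl | ha' <;> rcases Finset.mem_insert.1 hb with rfl | hb'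
    · exact G.irrefl
    · exact h1 b hb'
    · exact fun h => h1 a ha' h.symm
    · exact hI.indep a (Finset.mem_of_mem_erase ha') b (Finset.mem_of_mem_erase hb')
  · intro a ha
    rcases Finset.mem_insert.1 ha with rfl | ha'
    · exact hu
    · exact hI.allowed a (Finset.mem_of_mem_erase ha')
  · intro z hz
    rcases hI.forced z hz with h | ⟨y, hy, hzy⟩
    · by_cases hzx : z = x
      · subst hzx
        exact Or.inr ⟨u, by simp, hux.symm⟩
      · exact Or.inl (by simp [hzx, h])
    · by_cases hyx : y = x
      · subst hyx
        rw [hG.adj_unique hx.1.1 hz.1 hu.1 hzy.symm hux.symm]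
        exact Or.inl (by simp)
      · exact Or.inr ⟨y, by simp [hyx, hy], hzy⟩

/-- This is why forced vertices come first in `Precedes`: the partner of an unforced leaf `u` cannot
be forced, so no forced vertex relies on `u`. -/
theorem isLeafSet_erase {G : SimpleGraph V} (hG : NoC4567 G) {v u : V} (hu : Leaf G v u)
    (huf : ¬ Forced G v u) (hc : 2 ≤ (leaves G v).card) :
    IsLeafSet G v ((leaves G v).erase u) := by
  have hI := isLeafSet_leaves hG ⟨u, mem_leaves.2 hu⟩
  refine ⟨?_, fun a ha b hb => hI.indep a (Finset.mem_of_mem_erase ha) b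
    (Finset.mem_of_mem_erase hb), fun a ha => hI.allowed a (Finset.mem_of_mem_erase ha), ?_⟩
  · rw [← Finset.card_pos, Finset.card_erase_of_mem (mem_leaves.2 hu)]; omega
  · intro z hz
    rcases hI.forced z hz with h | ⟨y, hy, hzy⟩
    · refine Or.inl (Finset.mem_erase.2 ⟨?_, h⟩)
      rintro rfl; exact huf hz
    · by_cases hyu : y = u
      · subst hyu
        have := hu.2 z hz.allowed hzy.symm
        unfold Precedes at this
        tauto
      · exact Or.inr ⟨y, by simp [hyu, hy], hzy⟩

open Classical in
theorem sum_row_self {G : SimpleGraph V} {v : V} (h : (leaves G v).Nonempty) (w : V → ℝ) :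
    ∑ x, (row G v v x : ℝ) * w x = w v - ∑ x ∈ leaves G v, w x := by
  simp [row, h, sub_mul, Finset.sum_sub_distrib, Finset.sum_ite_mem]

theorem sum_row_leaf {G : SimpleGraph V} {v u : V} (hu : Leaf G v u) (huf : ¬ Forced G v u)
    (hc : 2 ≤ (leaves G v).card) (w : V → ℝ) :
    ∑ x, (row G v u x : ℝ) * w x = w u := by
  simp [row, mem_leaves.2 hu, hu.1.1.ne.symm, huf, hc]

theorem sum_row_swap {G : SimpleGraph V} (hG : NoC4567 G) {v u y : V} (hu : Allowed G v u)
    (hul : ¬ Leaf G v u) (hy : Leaf G v y) (huy : G.Adj u y) (w : V → ℝ) :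
    ∑ x, (row G v u x : ℝ) * w x = w u - w y := by
  have h1 : ∀ x, (x ∈ leaves G v ∧ G.Adj u x) ↔ x = y := by
    intro x
    constructor
    · rintro ⟨hx, hux⟩
      exact hG.adj_unique hu.1 (mem_leaves.1 hx).1.1 hy.1.1 hux huy
    · rintro rfl; exact ⟨mem_leaves.2 hy, huy⟩
  have h2 : ∀ x, (row G v u x : ℝ) = (if x = u then 1 else 0) - (if x = y then 1 else 0) := by
    intro x
    rw [row, if_neg hu.1.ne.symm, if_neg (fun h => hul (mem_leaves.1 h)), if_pos hu]
    by_cases hxy : x = y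
    · rw [if_pos ((h1 x).2 hxy), if_pos hxy]; push_cast; rfl
    · rw [if_neg (fun h => hxy ((h1 x).1 h)), if_neg hxy]; push_cast; rfl
  simp [h2, sub_mul, Finset.sum_sub_distrib]

/-- The equations are the constraint of the canonical leaf set and its differences with those of the
leaf sets obtained by one deletion (`w u = 0`) or one swap (`w u = w x`). Conversely, these
equations carry the constraint from the canonical leaf set to any `Y`. -/
theorem mem_wellCoveredSpace_iff_row {G : SimpleGraph V} (hG : NoC4567 G) {w : V → ℝ} :
    w ∈ wellCoveredSpace G ↔ ∀ v u, ∑ x, (row G v u x : ℝ) * w x = 0 := by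
  classical
  have hmem : w ∈ wellCoveredSpace G ↔ ∀ v Y, IsLeafSet G v Y → w v = ∑ y ∈ Y, w y := by
    rw [wellCoveredSpace_eq_iInf_starSpace hG, Submodule.mem_iInf]
    refine forall_congr' fun v => ?_
    change (∀ Y : Finset V, IsGenerating G {v} Y → ∑ x ∈ {v}, w x = ∑ y ∈ Y, w y) ↔ _
    simp only [isGenerating_singleton_iff hG, Finset.sum_singleton]
  rw [hmem]
  constructor
  · intro h v u
    by_cases huv : u = v
    · subst huv
      by_cases hne : (leaves G u).Nonempty
      · rw [sum_row_self hne, h u _ (isLeafSet_leaves hG hne), sub_self]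
      · simp [row, hne]
    by_cases hul : Leaf G v u
    · by_cases hc : ¬ Forced G v u ∧ 2 ≤ (leaves G v).card
      · rw [sum_row_leaf hul hc.1 hc.2]
        have h1 := h v _ (isLeafSet_leaves hG ⟨u, mem_leaves.2 hul⟩)
        have h2 := h v _ (isLeafSet_erase hG hul hc.1 hc.2)
        rw [← Finset.add_sum_erase _ _ (mem_leaves.2 hul)] at h1
        linarith
      · simp [row, huv, mem_leaves, hul, hc]
    by_cases hu : Allowed G v u
    · obtain ⟨x, hx, hux⟩ := hu.exists_leaf hG hul
      rw [sum_row_swap hG hu hul hx hux]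
      have h1 := h v _ (isLeafSet_leaves hG ⟨x, mem_leaves.2 hx⟩)
      have h2 := h v _ (isLeafSet_swap hG hu hx hux)
      rw [← Finset.add_sum_erase _ _ (mem_leaves.2 hx)] at h1
      rw [Finset.sum_insert (by simp [mem_leaves, hul])] at h2
      linarith
    · simp [row, huv, mem_leaves, hul, hu]
  · intro h v Y hY
    -- Each `u ∈ Y` is replaced by itself if it is a canonical leaf and by its partner otherwise,
    -- without a change of weight.
    have hf : ∀ u, ∃ x, u ∈ Y → Leaf G v x ∧ (x = u ∨ (G.Adj u x ∧ ¬ Leaf G v u)) ∧ w u = w x := by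
      intro u
      by_cases hu : u ∈ Y
      · by_cases hul : Leaf G v u
        · exact ⟨u, fun _ => ⟨hul, Or.inl rfl, rfl⟩⟩
        · obtain ⟨x, hx, hux⟩ := (hY.allowed u hu).exists_leaf hG hul
          have := h v u
          rw [sum_row_swap hG (hY.allowed u hu) hul hx hux] at this
          exact ⟨x, fun _ => ⟨hx, Or.inr ⟨hux, hul⟩, by linarith⟩⟩
      · exact ⟨u, fun h => (hu h).elim⟩
    choose f hf using hf
    have hinj : Set.InjOn f Y := by
      intro a ha b hb hab
      obtain ⟨ha1, ha2, -⟩ := hf a ha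
      obtain ⟨hb1, hb2, -⟩ := hf b hb
      rw [← hab] at hb1 hb2
      rcases ha2 with ha2 | ha2 <;> rcases hb2 with hb2 | hb2
      · rw [← ha2, hb2]
      · rw [ha2] at hb2; exact (hY.indep b hb a ha hb2.1).elim
      · rw [hb2] at ha2; exact (hY.indep a ha b hb ha2.1).elim
      · exact hG.adj_unique ha1.1.1 (hY.allowed a ha).1 (hY.allowed b hb).1 ha2.1.symm hb2.1.symm
    have hsub : Y.image f ⊆ leaves G v := by
      intro x hx
      obtain ⟨u, hu, rfl⟩ := Finset.mem_image.1 hx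
      exact mem_leaves.2 (hf u hu).1
    have hne : (leaves G v).Nonempty := (hY.nonempty.image f).mono hsub
    have h0 := h v v
    rw [sum_row_self hne] at h0
    rw [Finset.sum_congr rfl fun u hu => (hf u hu).2.2, ← Finset.sum_image (f := w) hinj,
      Finset.sum_subset hsub, ← sub_eq_zero, h0]
    intro x hx hxY
    have hxl := mem_leaves.1 hx
    -- A leaf missed by the image is unforced: a forced one lies in `Y` or has its partner in `Y`,
    -- and is hit in both cases. With a second leaf present, its weight is `0`.
    have hxf : ¬ Forced G v x := by
      intro hxf
      rcases hY.forced x hxf with hx' | ⟨u, hu, hxu⟩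
      · refine hxY (Finset.mem_image.2 ⟨x, hx', ?_⟩)
        rcases (hf x hx').2.1 with h | h
        · exact h
        · exact (h.2 hxl).elim
      · refine hxY (Finset.mem_image.2 ⟨u, hu, ?_⟩)
        obtain ⟨h1, h2 | h2, -⟩ := hf u hu
        · rw [h2] at h1; exact (hxl.not_adj h1 hxu).elim
        · exact hG.adj_unique (hY.allowed u hu).1 h1.1.1 hxl.1.1 h2.1 hxu.symm
    have hc : 2 ≤ (leaves G v).card := by
      obtain ⟨y, hy⟩ := hY.nonempty.image f
      have : ({x, y} : Finset V) ⊆ leaves G v := by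
        intro z hz
        simp only [Finset.mem_insert, Finset.mem_singleton] at hz
        rcases hz with rfl | rfl
        · exact hx
        · exact hsub hy
      have hxy : x ≠ y := by rintro rfl; exact hxY hy
      rw [← Finset.card_pair hxy]
      exact Finset.card_le_card this
    rw [← sum_row_leaf hxl hxf hc w, h v x]

end Rows

/-! ### Fraction-free elimination through the adjugate -/

section Elimination

open Matrix

variable {ι : Type*} [Fintype ι] [DecidableEq ι]

/-- Cramer's rule. The value of the new equation on column `f` of the adjugate is also the
determinant after the replacement of row `f`, so a non-zero value signals a valid pivot. -/
theorem det_updateRow_eq_vecMul_adjugate (M : Matrix ι ι ℤ) (f : ι) (c : ι → ℤ) :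
    (M.updateRow f c).det = (c ᵥ* M.adjugate) f := by
  rw [← cramer_transpose_apply, cramer_eq_adjugate_mulVec, ← adjugate_transpose, mulVec_transpose]

theorem adjugate_updateRow_self (M : Matrix ι ι ℤ) (f : ι) (c : ι → ℤ) (x : ι) :
    (M.updateRow f c).adjugate x f = M.adjugate x f := by
  rw [adjugate_apply, adjugate_apply, updateRow_idem]

/-- Write `r = c ᵥ* M.adjugate`, `M'` for the updated matrix and `z` for the right-hand side as a
vector in `x`. Then `M' z = det M · r f · e_g`: outside of row `f` this is `M · adj M = det M`, and
in row `f` the two terms cancel. Applying `adj M'` and cancelling `det M' = r f` gives the claim; it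
makes the division by `det M` exact. -/
theorem det_mul_adjugate_updateRow (M : Matrix ι ι ℤ) {f : ι} (c : ι → ℤ)
    (hf : (c ᵥ* M.adjugate) f ≠ 0) (x g : ι) (hg : g ≠ f) :
    M.det * (M.updateRow f c).adjugate x g =
      (c ᵥ* M.adjugate) f * M.adjugate x g - (c ᵥ* M.adjugate) g * M.adjugate x f := by
  set M' := M.updateRow f c with hM'
  have hdet : M'.det = (c ᵥ* M.adjugate) f := det_updateRow_eq_vecMul_adjugate M f c
  set r := c ᵥ* M.adjugate with hr
  let z : ι → ℤ := fun x => r f * M.adjugate x g - r g * M.adjugate x f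
  have hz : z = r f • (fun x => M.adjugate x g) - r g • (fun x => M.adjugate x f) := by
    ext; simp [z]
  have hMcol : ∀ h, M *ᵥ (fun x => M.adjugate x h) = Pi.single h M.det := by
    intro h; ext i
    have := congrFun (congrFun (mul_adjugate M) i) h
    rw [mul_apply] at this
    rw [mulVec, dotProduct, this, Matrix.smul_apply, one_apply, Pi.single_apply]; simp
  have h1 : M' *ᵥ z = Pi.single g (M.det * r f) := by
    ext i
    by_cases hi : i = f
    · subst hi
      have : ∀ h, (M' *ᵥ fun x => M.adjugate x h) i = r h := by
        intro h; rw [mulVec, hM', updateRow_self]; rfl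
      rw [hz, mulVec_sub, mulVec_smul, mulVec_smul, Pi.sub_apply, Pi.smul_apply, Pi.smul_apply,
        this,
        this, Pi.single_eq_of_ne hg.symm, smul_eq_mul, smul_eq_mul, mul_comm, sub_self]
    · have : ∀ h, (M' *ᵥ fun x => M.adjugate x h) i = (Pi.single h M.det : ι → ℤ) i := by
        intro h; rw [← hMcol h, mulVec, hM', updateRow_ne hi]; rfl
      rw [hz, mulVec_sub, mulVec_smul, mulVec_smul, Pi.sub_apply, Pi.smul_apply, Pi.smul_apply,
        this,
        this, Pi.single_eq_of_ne hi, Pi.single_apply, Pi.single_apply]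
      split_ifs <;> simp [mul_comm]
  have h2 : M'.adjugate *ᵥ (M' *ᵥ z) = M'.det • z := by
    rw [mulVec_mulVec, adjugate_mul, smul_mulVec, one_mulVec]
  rw [h1, hdet] at h2
  have h3 := congrFun h2 x
  rw [mulVec_single] at h3
  simp only [Pi.smul_apply, smul_eq_mul, MulOpposite.smul_eq_mul_unop, MulOpposite.unop_op,
    col_apply] at h3
  apply mul_left_cancel₀ hf
  change _ = r f * z x
  rw [← h3]; ring

/-- The state of the fraction-free elimination after the equations with coefficient vectors in `C`
have been processed: the rows of `M` with indices in `P` are taken from `C`, the other rows are unit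
vectors, and the columns of the adjugate with indices outside of `P` solve the equations. -/
structure EliminationState (C : Set (ι → ℤ)) (M : Matrix ι ι ℤ) (P : Set ι) : Prop where
  det_ne : M.det ≠ 0
  bound : ∀ i j, |M i j| ≤ 1
  free : ∀ f ∉ P, M f = Pi.single f 1
  pivot : ∀ f ∈ P, M f ∈ C
  solves : ∀ c ∈ C, ∀ f ∉ P, (c ᵥ* M.adjugate) f = 0

theorem abs_det_le {M : Matrix ι ι ℤ} (h : ∀ i j, |M i j| ≤ 1) :
    |M.det| ≤ (Fintype.card ι).factorial := by
  have := Matrix.det_le (abv := AbsoluteValue.abs) (A := M) (x := 1) h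
  simpa using this

theorem EliminationState.init : EliminationState (∅ : Set (ι → ℤ)) 1 ∅ where
  det_ne := by simp
  bound i j := by rw [one_apply]; split_ifs <;> simp
  free f _ := by ext j; simp [one_apply, Pi.single_apply, eq_comm]
  pivot := by simp
  solves := by simp

variable {C : Set (ι → ℤ)} {M : Matrix ι ι ℤ} {P : Set ι}

/-- The number is the determinant of `M` with row `f` replaced by `c`, whose entries are still at
most `1` in absolute value. -/
theorem EliminationState.abs_vecMul_le (h : EliminationState C M P) {c : ι → ℤ}
    (hc : ∀ i, |c i| ≤ 1) (f : ι) : |(c ᵥ* M.adjugate) f| ≤ (Fintype.card ι).factorial := by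
  rw [← det_updateRow_eq_vecMul_adjugate]
  apply abs_det_le
  intro i j
  rw [updateRow_apply]
  split_ifs
  · exact hc j
  · exact h.bound i j

theorem EliminationState.abs_adjugate_le (h : EliminationState C M P) (i f : ι) :
    |M.adjugate i f| ≤ (Fintype.card ι).factorial := by
  have := h.abs_vecMul_le (c := Pi.single i 1)
    (by intro j; rw [Pi.single_apply]; split_ifs <;> simp) f
  simpa using this

theorem EliminationState.insert_of_eq_zero (h : EliminationState C M P) {c : ι → ℤ}
    (hc : ∀ f ∉ P, (c ᵥ* M.adjugate) f = 0) : EliminationState (insert c C) M P where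
  det_ne := h.det_ne
  bound := h.bound
  free := h.free
  pivot f hf := Set.mem_insert_of_mem _ (h.pivot f hf)
  solves c' hc' := by
    rcases Set.mem_insert_iff.1 hc' with rfl | hc'
    · exact hc
    · exact h.solves c' hc'

theorem EliminationState.insert_of_ne_zero (h : EliminationState C M P) {c : ι → ℤ}
    (hc : ∀ i, |c i| ≤ 1) {f : ι} (hf : f ∉ P) (hcf : (c ᵥ* M.adjugate) f ≠ 0) :
    EliminationState (insert c C) (M.updateRow f c) (insert f P) where
  det_ne := by rwa [det_updateRow_eq_vecMul_adjugate]
  bound i j := by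
    rw [updateRow_apply]
    split_ifs
    · exact hc j
    · exact h.bound i j
  free g hg := by
    rw [Set.mem_insert_iff, not_or] at hg
    rw [updateRow_ne hg.1, h.free g hg.2]
  pivot g hg := by
    by_cases hgf : g = f
    · rw [hgf, updateRow_self]; exact Set.mem_insert _ _
    · rw [updateRow_ne hgf]
      exact Set.mem_insert_of_mem _ (h.pivot g (Set.mem_of_mem_insert_of_ne hg hgf))
  solves c' hc' g hg := by
    rw [Set.mem_insert_iff, not_or] at hg
    apply (mul_eq_zero.1 _).resolve_left h.det_ne
    -- The right-hand side vanishes by symmetry for the new equation `c' = c`, and for an old one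
    -- because both `f` and `g` are free columns.
    have : M.det * (c' ᵥ* (M.updateRow f c).adjugate) g =
        (c ᵥ* M.adjugate) f * (c' ᵥ* M.adjugate) g -
        (c ᵥ* M.adjugate) g * (c' ᵥ* M.adjugate) f := by
      simp only [vecMul, dotProduct] at hcf ⊢
      rw [Finset.mul_sum, Finset.mul_sum (f := fun x => c' x * M.adjugate x g),
        Finset.mul_sum (f := fun x => c' x * M.adjugate x f), ← Finset.sum_sub_distrib]
      refine Finset.sum_congr rfl fun x _ => ?_
      have := det_mul_adjugate_updateRow M c hcf x g hg.1
      simp only [vecMul, dotProduct] at this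
      linear_combination c' x * this
    rw [this]
    rcases Set.mem_insert_iff.1 hc' with rfl | hc'
    · ring
    · rw [h.solves c' hc' g hg.2, h.solves c' hc' f hf]; ring

/-- The determinant of the adjugate is a power of `det M`, hence non-zero. -/
theorem EliminationState.linearIndependent (h : EliminationState C M P) :
    LinearIndependent ℝ (fun (f : ι) (x : ι) => (M.adjugate x f : ℝ)) := by
  have hdet : ((M.map (Int.castRingHom ℝ))ᵀ.adjugate).det ≠ 0 := by
    rw [det_adjugate, det_transpose, ← RingHom.mapMatrix_apply, ← RingHom.map_det]
    exact pow_ne_zero _ (by simpa using h.det_ne)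
  have := Matrix.linearIndependent_rows_of_det_ne_zero hdet
  have e : (fun (f : ι) (x : ι) => (M.adjugate x f : ℝ)) =
      fun f => (M.map (Int.castRingHom ℝ))ᵀ.adjugate f := by
    ext f x
    rw [← adjugate_transpose, ← RingHom.mapMatrix_apply, ← RingHom.map_adjugate]
    rfl
  rw [e]
  exact this

/-- For a solution `w`, expand `det M · w = adj M (M w)`. The entries of `M w` at pivots vanish
because these rows are equations, so only free columns contribute; no dimension count is needed. -/
theorem EliminationState.span_eq (h : EliminationState C M P) :
    (Submodule.span ℝ (Set.range fun (f : ↥Pᶜ) (x : ι) => (M.adjugate x f : ℝ)) :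
      Set (ι → ℝ)) = {w | ∀ c ∈ C, ∑ x, (c x : ℝ) * w x = 0} := by
  apply Set.Subset.antisymm
  · intro w hw
    refine Submodule.span_induction (p := fun w _ => ∀ c ∈ C, ∑ x, (c x : ℝ) * w x = 0)
      ?_ ?_ ?_ ?_ hw
    · rintro _ ⟨f, rfl⟩ c hc
      have := h.solves c hc f f.2
      simp only [vecMul, dotProduct] at this
      change ∑ x, (c x : ℝ) * (M.adjugate x f : ℝ) = 0
      exact_mod_cast this
    · simp
    · intro a b _ _ ha hb c hc
      simp [mul_add, Finset.sum_add_distrib, ha c hc, hb c hc]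
    · intro r a _ ha c hc
      have := ha c hc
      simp only [Pi.smul_apply, smul_eq_mul, mul_left_comm _ r, ← Finset.mul_sum, this, mul_zero]
  · intro w hw
    have hdet : (M.det : ℝ) ≠ 0 := by exact_mod_cast h.det_ne
    set N := M.map (Int.castRingHom ℝ) with hN
    have hadj : N.adjugate = M.adjugate.map (Int.castRingHom ℝ) := by
      rw [hN, ← RingHom.mapMatrix_apply, ← RingHom.map_adjugate]; rfl
    have hNdet : N.det = M.det := by
      rw [hN, ← RingHom.mapMatrix_apply, ← RingHom.map_det]; rfl
    have h1 : (M.det : ℝ) • w = N.adjugate *ᵥ (N *ᵥ w) := by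
      rw [mulVec_mulVec, adjugate_mul, smul_mulVec, one_mulVec, hNdet]
    have h2 : w = ∑ f, ((M.det : ℝ)⁻¹ * (N *ᵥ w) f) • fun x => (M.adjugate x f : ℝ) := by
      refine (inv_smul_smul₀ hdet w).symm.trans ?_
      rw [h1]
      ext x
      rw [Pi.smul_apply, mulVec, dotProduct, Finset.sum_apply, Finset.smul_sum]
      refine Finset.sum_congr rfl fun f _ => ?_
      have h3 : N.adjugate x f = M.adjugate x f := by rw [hadj]; rfl
      rw [h3, Pi.smul_apply, smul_eq_mul, smul_eq_mul]
      ring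
    rw [h2]
    refine Submodule.sum_mem _ fun f _ => ?_
    by_cases hf : f ∈ P
    · have : (N *ᵥ w) f = 0 := hw _ (h.pivot f hf)
      rw [this, mul_zero, zero_smul]; exact Submodule.zero_mem _
    · exact Submodule.smul_mem _ _ (Submodule.subset_span ⟨⟨f, hf⟩, rfl⟩)

end Elimination

/-! ### Time and bit-length calculus for programs -/

section Machine

/-- All constants of an expression are among `0`, `1`, `2`. -/
def Exp.smallConsts : Exp → Bool
  | .const c => 0 ≤ c && c ≤ 2
  | .cell _ i j => i.smallConsts && j.smallConsts
  | .add e f => e.smallConsts && f.smallConsts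
  | .sub e f => e.smallConsts && f.smallConsts
  | .mul e f => e.smallConsts && f.smallConsts
  | .div e f => e.smallConsts && f.smallConsts

theorem Exp.one_le_time (e : Exp) : 1 ≤ e.time := by
  cases e <;> simp [Exp.time]

theorem natAbs_lt_two_pow_of_le_add {x y z : ℤ} {a b : ℕ} (hx : x.natAbs < 2 ^ a)
    (hy : y.natAbs < 2 ^ b) (ha : 1 ≤ a) (hb : 1 ≤ b) (h : z.natAbs ≤ x.natAbs + y.natAbs) :
    z.natAbs < 2 ^ (a + b) := by
  have h1 : 2 ^ 1 ≤ 2 ^ a := Nat.pow_le_pow_right (by norm_num) ha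
  have h2 : 2 ^ 1 ≤ 2 ^ b := Nat.pow_le_pow_right (by norm_num) hb
  rw [pow_add]
  nlinarith

/-- Each operation yields a number at most as long as its operands together, so lengths grow no
faster than `k` times the number of steps. This covers intermediate products that exceed the bound
for stored cells; `2 ≤ k` accommodates the constants. -/
theorem Exp.val_bits_le {s : Mem} {k : ℕ} (hk : 2 ≤ k) (hs : ∀ a i j, (s a i j).natAbs.size ≤ k)
    (e : Exp) (he : e.smallConsts = true) :
    (e.val s).natAbs.size ≤ k * e.time ∧ e.bits s ≤ k * e.time := by
  have key : ∀ (e f g : Exp), (e.val s).natAbs.size ≤ k * e.time →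
      (f.val s).natAbs.size ≤ k * f.time →
      ((g.val s).natAbs ≤ (e.val s).natAbs + (f.val s).natAbs ∨
        (g.val s).natAbs ≤ (e.val s).natAbs * (f.val s).natAbs) →
      (g.val s).natAbs.size ≤ k * (e.time + f.time + 1) := by
    intro e f g h1 h2 h
    have hle : k * e.time + k * f.time ≤ k * (e.time + f.time + 1) := by
      rw [← mul_add]; exact Nat.mul_le_mul_left _ (by omega)
    refine le_trans (Nat.size_le.2 ?_) hle
    rcases h with h | h
    · exact natAbs_lt_two_pow_of_le_add (Nat.size_le.1 h1) (Nat.size_le.1 h2)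
        (by nlinarith [e.one_le_time]) (by nlinarith [f.one_le_time]) h
    · rw [pow_add]
      exact lt_of_le_of_lt h (Nat.mul_lt_mul'' (Nat.size_le.1 h1) (Nat.size_le.1 h2))
  have mono : ∀ {a b c : ℕ}, a ≤ k * b → b ≤ c → a ≤ k * c :=
    fun h h' => h.trans (Nat.mul_le_mul_left _ h')
  induction e with
  | const c =>
    simp only [Exp.smallConsts, Bool.and_eq_true, decide_eq_true_eq] at he
    have : c.natAbs.size ≤ 2 := by
      rw [Nat.size_le]; omega
    simp only [Exp.val, Exp.bits, Exp.time]
    omega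
  | cell a i j ihi ihj =>
    simp only [Exp.smallConsts, Bool.and_eq_true] at he
    obtain ⟨-, h2⟩ := ihi he.1
    obtain ⟨-, h4⟩ := ihj he.2
    have h5 : ((Exp.cell a i j).val s).natAbs.size ≤ k * (i.time + j.time + 1) :=
      mono (b := 1) (by simpa [Exp.val] using hs _ _ _) (by omega)
    exact ⟨h5, max_le (max_le (mono h2 (by simp [Exp.time]; omega))
      (mono h4 (by simp [Exp.time]; omega))) h5⟩
  | add e f ihe ihf =>
    simp only [Exp.smallConsts, Bool.and_eq_true] at he
    obtain ⟨h1, h2⟩ := ihe he.1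
    obtain ⟨h3, h4⟩ := ihf he.2
    have h5 := key e f (.add e f) h1 h3 (Or.inl (Int.natAbs_add_le _ _))
    exact ⟨h5, max_le (max_le (mono h2 (by simp [Exp.time]; omega))
      (mono h4 (by simp [Exp.time]; omega))) h5⟩
  | sub e f ihe ihf =>
    simp only [Exp.smallConsts, Bool.and_eq_true] at he
    obtain ⟨h1, h2⟩ := ihe he.1
    obtain ⟨h3, h4⟩ := ihf he.2
    have h5 := key e f (.sub e f) h1 h3 (Or.inl (by simp only [Exp.val]; omega))
    exact ⟨h5, max_le (max_le (mono h2 (by simp [Exp.time]; omega))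
      (mono h4 (by simp [Exp.time]; omega))) h5⟩
  | mul e f ihe ihf =>
    simp only [Exp.smallConsts, Bool.and_eq_true] at he
    obtain ⟨h1, h2⟩ := ihe he.1
    obtain ⟨h3, h4⟩ := ihf he.2
    have h5 := key e f (.mul e f) h1 h3 (Or.inr (by simp only [Exp.val, Int.natAbs_mul, le_refl]))
    exact ⟨h5, max_le (max_le (mono h2 (by simp [Exp.time]; omega))
      (mono h4 (by simp [Exp.time]; omega))) h5⟩
  | div e f ihe ihf =>
    simp only [Exp.smallConsts, Bool.and_eq_true] at he
    obtain ⟨h1, h2⟩ := ihe he.1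
    obtain ⟨h3, h4⟩ := ihf he.2
    have h5 := key e f (.div e f) h1 h3 (Or.inl (by
      simp only [Exp.val]
      exact (Int.natAbs_ediv_le_natAbs _ _).trans (Nat.le_add_right _ _)))
    exact ⟨h5, max_le (max_le (mono h2 (by simp [Exp.time]; omega))
      (mono h4 (by simp [Exp.time]; omega))) h5⟩

/-- The memory holds `n` in its cell `(0, 0)` of the array `0`, and no cell exceeds `N`. -/
structure Mem.Ok (n N : ℕ) (s : Mem) : Prop where
  size_eq : s 0 0 0 = n
  abs_le : ∀ a i j, |s a i j| ≤ N

/-- Started on `s`, the program `p` halts after at most `c (n + 1) ^ d` steps with a memory that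
satisfies `Q`, where the cells remain bounded by `N`, and all intermediate results
have a binary length that exceeds the one of `N` only by a constant factor. -/
def Achieves (n N : ℕ) (p : Prog) (s : Mem) (c d : ℕ) (Q : Mem → Prop) : Prop :=
  ∃ t b s', Run p s t b s' ∧ t ≤ c * (n + 1) ^ d ∧ b ≤ (N.size + 2) * 1000 ∧ s'.Ok n N ∧ Q s'

/-- The expressions that are used in programs. -/
def Exp.short (e : Exp) : Bool := e.smallConsts && e.time ≤ 1000

variable {n N : ℕ} {p q : Prog} {s : Mem} {c c' d d' : ℕ} {Q Q' : Mem → Prop}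

theorem Exp.bits_le_of_short {e : Exp} (he : e.short = true) (hs : s.Ok n N) :
    e.bits s ≤ (N.size + 2) * 1000 := by
  simp only [Exp.short, Bool.and_eq_true, decide_eq_true_eq] at he
  refine (Exp.val_bits_le (k := N.size + 2) (by omega) (fun a i j => ?_) e he.1).2.trans
    (Nat.mul_le_mul_left _ he.2)
  have : (s a i j).natAbs ≤ N := by have := abs_le.1 (hs.abs_le a i j); omega
  exact (Nat.size_le_size this).trans (by omega)

theorem Exp.time_le_of_short {e : Exp} (he : e.short = true) : e.time ≤ 1000 := by
  simp only [Exp.short, Bool.and_eq_true, decide_eq_true_eq] at he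
  exact he.2

theorem Achieves.mono (h : Achieves n N p s c d Q) (hc : c ≤ c') (hd : d ≤ d')
    (hQ : ∀ s', s'.Ok n N → Q s' → Q' s') : Achieves n N p s c' d' Q' := by
  obtain ⟨t, b, s', h1, h2, h3, h4, h5⟩ := h
  exact ⟨t, b, s', h1, h2.trans (Nat.mul_le_mul hc (Nat.pow_le_pow_right (by omega) hd)), h3, h4,
    hQ s' h4 h5⟩

theorem Achieves.seq {c₁ c₂ : ℕ} (h : Achieves n N p s c₁ d fun s' =>
    Achieves n N q s' c₂ d Q) : Achieves n N (.seq p q) s (c₁ + c₂) d Q := by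
  obtain ⟨t, b, s', h1, h2, h3, h4, t', b', s'', k1, k2, k3, k4, k5⟩ := h
  exact ⟨_, _, s'', .seq h1 k1, by rw [add_mul]; omega, max_le h3 k3, k4, k5⟩

theorem Mem.Ok.store (hs : s.Ok n N) {a : ℕ} (ha : a ≠ 0) (i j : ℤ) {x : ℤ} (hx : |x| ≤ N) :
    (s.store a i j x).Ok n N where
  size_eq := by simp [Mem.store, ha.symm, hs.size_eq]
  abs_le a' i' j' := by
    unfold Mem.store
    split_ifs
    · exact hx
    · exact hs.abs_le a' i' j'

/-- The time bound 3001 stands for three expressions of at most 1000 steps each and one step for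
storing. -/
theorem Achieves.write (hs : s.Ok n N) {a : ℕ} {i j e : Exp} (ha : a ≠ 0)
    (hi : i.short = true) (hj : j.short = true) (he : e.short = true) (hv : |e.val s| ≤ N)
    (hQ : Q (s.store a (i.val s) (j.val s) (e.val s))) :
    Achieves n N (.write a i j e) s 3001 0 Q := by
  refine ⟨_, _, _, .write s a i j e, ?_, ?_, hs.store ha _ _ hv, hQ⟩
  · have := Exp.time_le_of_short hi
    have := Exp.time_le_of_short hj
    have := Exp.time_le_of_short he
    rw [pow_zero]; omega
  · exact max_le (max_le (Exp.bits_le_of_short hi hs) (Exp.bits_le_of_short hj hs))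
      (Exp.bits_le_of_short he hs)

theorem Achieves.skip (hs : s.Ok n N) (hQ : Q s) : Achieves n N .skip s 1 0 Q :=
  ⟨_, _, _, .skip s, by simp, by omega, hs, hQ⟩

theorem Achieves.branch (hs : s.Ok n N) {e : Exp} (he : e.short = true)
    (hp : 0 < e.val s → Achieves n N p s c d Q) (hq : ¬ 0 < e.val s → Achieves n N q s c d Q) :
    Achieves n N (.branch e p q) s (c + 1001) d Q := by
  have h1 := Exp.time_le_of_short he
  have h2 := Exp.bits_le_of_short he hs
  have h3 : 1 ≤ (n + 1) ^ d := Nat.one_le_pow _ _ (by omega)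
  by_cases h : 0 < e.val s
  · obtain ⟨t, b, s', k1, k2, k3, k4, k5⟩ := hp h
    exact ⟨_, _, s', .branch_pos h k1, by nlinarith, max_le h2 k3, k4, k5⟩
  · obtain ⟨t, b, s', k1, k2, k3, k4, k5⟩ := hq h
    exact ⟨_, _, s', .branch_neg h k1, by nlinarith, max_le h2 k3, k4, k5⟩

/-- The scalar variable in the cell `(0, 0)` of the array `a`. -/
def scalar (a : ℕ) : Exp := .cell a (.const 0) (.const 0)

@[simp] theorem scalar_val (a : ℕ) (s : Mem) : (scalar a).val s = s a 0 0 := rfl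

/-- Run `p` for the values `0, …, n - 1` of the scalar variable `a`. -/
def forRange (a : ℕ) (p : Prog) : Prog :=
  .seq (.write a (.const 0) (.const 0) (.const 0))
    (.loop (.sub (scalar 0) (scalar a))
      (.seq p (.write a (.const 0) (.const 0) (.add (scalar a) (.const 1)))))

/-- The invariant `I i` refers to the moment when the counter has been set to `i`; hence the body
has to establish `I (i + 1)` for the memory after the increment, and to preserve the counter. -/
theorem Achieves.forRange (hs : s.Ok n N) (hN : n ≤ N) {a : ℕ} (ha : a ≠ 0) (I : ℕ → Mem → Prop)
    (h0 : I 0 (s.store a 0 0 0))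
    (hI : ∀ (i : Fin n) (s : Mem), s.Ok n N → s a 0 0 = (i : ℕ) → I i s →
      Achieves n N p s c d fun s' => s' a 0 0 = (i : ℕ) ∧ I (i + 1) (s'.store a 0 0 ((i : ℕ) + 1)))
    (hQ : ∀ s, s.Ok n N → I n s → Q s) :
    Achieves n N (forRange a p) s (c + 20) (d + 1) Q := by
  -- Each pass adds 8 steps for the test and 8 for the increment; the final test costs another 8.
  have hloop : ∀ m i : ℕ, i + m = n → ∀ s : Mem, s.Ok n N → s a 0 0 = i → I i s →
      ∃ t b s', Run (.loop (.sub (scalar 0) (scalar a))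
        (.seq p (.write a (.const 0) (.const 0) (.add (scalar a) (.const 1))))) s t b s' ∧
        t ≤ m * (c * (n + 1) ^ d + 16) + 8 ∧ b ≤ (N.size + 2) * 1000 ∧ s'.Ok n N ∧ I n s' := by
    intro m
    induction m with
    | zero =>
      intro i hi s hs hsa hIs
      obtain rfl : i = n := by omega
      refine ⟨_, _, s, .loop_neg ?_, ?_, Exp.bits_le_of_short ?_ hs, hs, hIs⟩
      · simp [Exp.val, hs.size_eq, hsa]
      · simp [Exp.time, scalar]
      · rfl
    | succ m ih =>
      intro i hi s hs hsa hIs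
      obtain ⟨t, b, s', k1, k2, k3, k4, k5, k6⟩ := hI ⟨i, by omega⟩ s hs hsa hIs
      have hle : |((i : ℕ) : ℤ) + 1| ≤ N := by
        rw [abs_of_nonneg (by positivity)]; omega
      obtain ⟨t', b', s'', l1, l2, l3, l4, l5⟩ := ih (i + 1) (by omega)
        (s'.store a 0 0 ((i : ℕ) + 1)) (k4.store ha _ _ hle) (by simp [Mem.store]) k6
      have hw := Run.write s' a (.const 0) (.const 0) (.add (scalar a) (.const 1))
      simp only [Exp.val, scalar_val, k5] at hw
      refine ⟨_, _, s'', .loop_pos ?_ (.seq k1 hw) l1, ?_, ?_, l4, l5⟩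
      · simp only [Exp.val, hs.size_eq, hsa, scalar_val]; omega
      · simp [Exp.time, scalar] at *; nlinarith
      · refine max_le (Exp.bits_le_of_short rfl hs) (max_le (max_le k3 ?_) l3)
        exact max_le (max_le (Exp.bits_le_of_short rfl k4) (Exp.bits_le_of_short rfl k4))
          (Exp.bits_le_of_short rfl k4)
  obtain ⟨t, b, s', k1, k2, k3, k4, k5⟩ := hloop n 0 (by omega) (s.store a 0 0 0)
    (hs.store ha _ _ (by simp)) (by simp [Mem.store]) h0
  refine ⟨_, _, s', .seq (.write s a (.const 0) (.const 0) (.const 0)) k1, ?_, ?_, k4, hQ s' k4 k5⟩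
  · have : 1 ≤ (n + 1) ^ d := Nat.one_le_pow _ _ (by omega)
    rw [pow_succ]
    simp only [Exp.time]
    nlinarith
  · exact max_le (max_le (max_le (Exp.bits_le_of_short rfl hs) (Exp.bits_le_of_short rfl hs))
      (Exp.bits_le_of_short rfl hs)) k3

end Machine

/-! ### Sums and tables as programs -/

section Gadgets

/-- An expression with the value `1` if the value of `e` is `0`, and `0` otherwise. -/
def isZero (e : Exp) : Exp := .div (.const 1) (.add (.const 1) (.mul e e))

theorem isZero_val (e : Exp) (s : Mem) : (isZero e).val s = if e.val s = 0 then 1 else 0 := by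
  simp only [isZero, Exp.val]
  split_ifs with h
  · simp [h]
  · have := mul_self_pos.2 h
    exact Int.ediv_eq_zero_of_lt (by norm_num) (by omega)

variable {n N : ℕ} {s s₀ : Mem} {c d : ℕ}

/-- `s` arises from `s₀` by storing `z` in the cell `(i, j)` of the array `a` and possibly changing
the array `12`. -/
def Updates (s₀ : Mem) (a : ℕ) (i j z : ℤ) (s : Mem) : Prop :=
  ∀ b, b ≠ 12 → s b = s₀.store a i j z b

theorem Achieves.write_updates (hs : s.Ok n N) {a : ℕ} {i j e : Exp} (ha : a ≠ 0)
    (hi : i.short = true) (hj : j.short = true) (he : e.short = true) {i' j' z : ℤ}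
    (hiv : i.val s = i') (hjv : j.val s = j') (hev : e.val s = z) (hv : |z| ≤ N) :
    Achieves n N (.write a i j e) s 3001 0 (Updates s a i' j' z) := by
  refine Achieves.write hs ha hi hj he (by rwa [hev]) fun b _ => ?_
  rw [hiv, hjv, hev]

/-- Store the sum of the values of `e` for the values `0, …, n - 1` of the scalar variable `12` in
the cell `(i, j)` of the array `a`. -/
def sumTo (a : ℕ) (i j e : Exp) : Prog :=
  .seq (.write a i j (.const 0)) (forRange 12 (.write a i j (.add (.cell a i j) e)))

theorem sum_filter_lt_succ {M : Type*} [AddCommMonoid M] (f : Fin n → M) (m : Fin n) :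
    ∑ x : Fin n with x.val < m.val + 1, f x = ∑ x : Fin n with x.val < m.val, f x + f m := by
  have : (Finset.univ.filter fun x : Fin n => x.val < m.val + 1) =
      insert m (Finset.univ.filter fun x : Fin n => x.val < m.val) := by
    ext x; simp [Fin.ext_iff]; omega
  rw [this, Finset.sum_insert (by simp), add_comm]

/-- The invariant is that the target cell holds a partial sum. `H` says that neither the accumulator
nor the loop counter disturbs the address, and that the accumulator does not disturb the summands.
Each partial sum is at most `n * F`, so the cell bound `N` persists. -/
theorem Achieves.sumTo (hs : s.Ok n N) (hN : n ≤ N) {a : ℕ} {i j e : Exp} (ha : a ≠ 0)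
    (ha' : a ≠ 12) (hi : i.short = true) (hj : j.short = true)
    (he' : (Exp.add (.cell a i j) e).short = true) {i' j' : ℤ} {f : Fin n → ℤ}
    (H : ∀ (z : ℤ) (s' : Mem), (∀ b, b ≠ 12 → s' b = s.store a i' j' z b) →
      i.val s' = i' ∧ j.val s' = j' ∧ ∀ x : Fin n, s' 12 0 0 = (x : ℕ) → e.val s' = f x)
    (h0 : i.val s = i' ∧ j.val s = j') {F : ℕ} (hF : ∀ x, |f x| ≤ F) (hFN : n * F ≤ N) :
    Achieves n N (sumTo a i j e) s 6022 1 (Updates s a i' j' (∑ x, f x)) := by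
  have hbound : ∀ S : Finset (Fin n), |∑ x ∈ S, f x| ≤ N := by
    intro S
    refine (Finset.abs_sum_le_sum_abs _ _).trans ((Finset.sum_le_card_nsmul _ _ _
      fun x _ => hF x).trans ?_)
    have : S.card ≤ n := by simpa using Finset.card_le_univ S
    rw [nsmul_eq_mul]
    have h2 : S.card * F ≤ N := (Nat.mul_le_mul_right _ this).trans hFN
    exact_mod_cast h2
  refine Achieves.seq (c₁ := 3001) (c₂ := 3021) ((Achieves.write_updates hs ha hi hj rfl h0.1 h0.2
    rfl (by simp [Exp.val])).mono le_rfl (by omega) fun s₁ hs₁ hu => ?_)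
  refine Achieves.forRange hs₁ hN (by norm_num)
    (fun m s' => ∀ b, b ≠ 12 → s' b = s.store a i' j' (∑ x : Fin n with x.val < m, f x) b) ?_ ?_ ?_
  · intro b hb
    have := hu b hb
    simp only [Exp.val] at this
    ext k l
    simp [Mem.store, hb, this]
  · intro m s₂ hs₂ h12 hI
    obtain ⟨e1, e2, e3⟩ := H _ s₂ hI
    have hc : s₂ a i' j' = ∑ x : Fin n with x.val < m.val, f x := by
      rw [hI a ha']; simp [Mem.store]
    have hv : (Exp.add (.cell a i j) e).val s₂ = ∑ x : Fin n with x.val < m.val + 1, f x := by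
      rw [sum_filter_lt_succ, Exp.val, Exp.val, e1, e2, hc, e3 m h12]
    refine Achieves.write hs₂ ha hi hj he' (by rw [hv]; exact hbound _) ?_
    rw [hv, e1, e2]
    refine ⟨by simp [Mem.store, ha'.symm, h12], fun b hb => ?_⟩
    ext k l
    have := congrFun (congrFun (hI b hb) k) l
    simp only [Mem.store] at this ⊢
    simp only [hb, false_and, if_false, this]
    split_ifs <;> rfl
  · intro s' _ hI b hb
    rw [hI b hb]
    congr
    ext x; simp

/-- `s` agrees with `s₀` outside of the arrays in `A`. -/
def AgreesOff (A : List ℕ) (s₀ s : Mem) : Prop := ∀ b, b ∉ A → s b = s₀ b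

theorem Achieves.fillRow (hs : s.Ok n N) (hN : n ≤ N) {a : ℕ} (ha : a ≠ 11 ∧ a ≠ 12)
    {p : Prog} {i' : ℤ} {f : Fin n → ℤ}
    (H : ∀ (j : Fin n) (s' : Mem), s'.Ok n N → AgreesOff [a, 11, 12] s s' → s' 11 0 0 = (j : ℕ) →
      Achieves n N p s' c d (Updates s' a i' (j : ℕ) (f j))) :
    Achieves n N (WWC.forRange 11 p) s (c + 20) (d + 1) fun s' => AgreesOff [a, 11, 12] s s' ∧
      (∀ j : Fin n, s' a i' (j : ℕ) = f j) ∧ ∀ i, i ≠ i' → s' a i = s a i := by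
  refine Achieves.forRange hs hN (by norm_num) (fun m s' => AgreesOff [a, 11, 12] s s' ∧
      (∀ j : Fin n, j.val < m → s' a i' (j : ℕ) = f j) ∧ ∀ i, i ≠ i' → s' a i = s a i) ?_ ?_ ?_
  · refine ⟨fun b hb => ?_, by simp, fun i hi => ?_⟩
    · simp only [List.mem_cons, not_or] at hb
      ext; simp [Mem.store, hb]
    · ext; simp [Mem.store, ha]
  · rintro m s' hs' h11 ⟨hI1, hI2, hI3⟩
    refine (H m s' hs' hI1 h11).mono le_rfl le_rfl fun s'' _ hu => ⟨?_, fun b hb => ?_,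
      fun j hj => ?_, fun i hi => ?_⟩
    · rw [hu 11 (by norm_num)]; simp [Mem.store, h11, ha.1.symm]
    · rw [← hI1 b hb]
      simp only [List.mem_cons, not_or] at hb
      ext k l
      simp only [Mem.store, hb, false_and, if_false]
      rw [hu b hb.2.2.1]; simp [Mem.store, hb]
    · simp only [Mem.store, ha.1, false_and, if_false]
      rw [hu a ha.2]
      simp only [Mem.store, true_and, Nat.cast_inj, Fin.val_inj]
      split_ifs with h
      · rw [h]
      · exact hI2 j (by rw [Fin.ext_iff] at h; omega)
    · rw [← hI3 i hi]
      ext l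
      simp only [Mem.store, ha.1, false_and, if_false]
      rw [hu a ha.2]
      simp [Mem.store, hi]
  · rintro s' _ ⟨h1, h2, h3⟩
    exact ⟨h1, fun j => h2 j j.2, h3⟩

theorem Achieves.fillTable (hs : s.Ok n N) (hN : n ≤ N) {a : ℕ} (ha : a ≠ 10 ∧ a ≠ 11 ∧ a ≠ 12)
    {p : Prog} {f : Fin n → Fin n → ℤ}
    (H : ∀ (i j : Fin n) (s' : Mem), s'.Ok n N → AgreesOff [a, 10, 11, 12] s s' →
      s' 10 0 0 = (i : ℕ) → s' 11 0 0 = (j : ℕ) →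
      Achieves n N p s' c d (Updates s' a (i : ℕ) (j : ℕ) (f i j))) :
    Achieves n N (WWC.forRange 10 (WWC.forRange 11 p)) s (c + 40) (d + 2) fun s' =>
      AgreesOff [a, 10, 11, 12] s s' ∧ ∀ i j : Fin n, s' a (i : ℕ) (j : ℕ) = f i j := by
  refine Achieves.forRange (c := c + 20) (d := d + 1) hs hN (by norm_num)
    (fun m s' => AgreesOff [a, 10, 11, 12] s s' ∧
      ∀ i : Fin n, i.val < m → ∀ j : Fin n, s' a (i : ℕ) (j : ℕ) = f i j) ?_ ?_ ?_
  · refine ⟨fun b hb => ?_, by simp⟩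
    simp only [List.mem_cons, not_or] at hb
    ext; simp [Mem.store, hb]
  · rintro m s' hs' h10 ⟨hI1, hI2⟩
    refine (Achieves.fillRow hs' hN ha.2 (i' := (m : ℕ)) (f := f m) fun j s'' hs'' h1 h11 =>
      H m j s'' hs'' (fun b hb => ?_) ?_ h11).mono le_rfl le_rfl
        fun s'' _ hu => ⟨?_, fun b hb => ?_, fun i hi j => ?_⟩
    · rw [← hI1 b hb]
      simp only [List.mem_cons, not_or] at hb
      exact h1 b (by simp [hb])
    · rw [← h10, h1 10 (by simp [ha.1.symm])]
    · rw [← h10, hu.1 10 (by simp [ha.1.symm])]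
    · rw [← hI1 b hb]
      simp only [List.mem_cons, not_or] at hb
      rw [← hu.1 b (by simp [hb])]
      ext; simp [Mem.store, hb]
    · simp only [Mem.store, ha.1, false_and, if_false]
      by_cases h : i = m
      · subst h; exact hu.2.1 j
      · rw [hu.2.2 _ (by simpa [Fin.ext_iff] using h)]
        exact hI2 i (by rw [Fin.ext_iff] at h; omega) j
  · rintro s' _ ⟨h1, h2⟩
    exact ⟨h1, fun i => h2 i i.2⟩

end Gadgets

/-! ### Truth values and coefficients as arithmetic expressions -/

section Tables

open Classical in
/-- The truth value of `p` as an integer. -/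
noncomputable def ind (p : Prop) : ℤ := if p then 1 else 0

theorem ind_of {p : Prop} (h : p) : ind p = 1 := if_pos h

theorem ind_of_not {p : Prop} (h : ¬ p) : ind p = 0 := if_neg h

theorem one_sub_ind (p : Prop) : 1 - ind p = ind (¬ p) := by
  by_cases h : p <;> simp [ind, h]

theorem ind_mul_ind (p q : Prop) : ind p * ind q = ind (p ∧ q) := by
  by_cases h : p <;> by_cases h' : q <;> simp [ind, h, h']

theorem abs_ind_le (p : Prop) : |ind p| ≤ (1 : ℕ) := by
  by_cases h : p <;> simp [ind, h]

theorem ite_eq_ind (p : Prop) [Decidable p] : (if p then (1 : ℤ) else 0) = ind p := by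
  by_cases h : p <;> simp [ind, h]

theorem ind_congr {p q : Prop} (h : p ↔ q) : ind p = ind q := by rw [propext h]

theorem sum_ind_eq_zero_iff {α : Type*} [Fintype α] (P : α → Prop) :
    ∑ x, ind (P x) = 0 ↔ ∀ x, ¬ P x := by
  rw [Finset.sum_eq_zero_iff_of_nonneg (fun x _ => by by_cases h : P x <;> simp [ind, h])]
  simp [ind]

variable {n N : ℕ} {s : Mem}

/-- Fill the array `a` with sums over the scalar variable `12`; the indices are the scalar
variables `10` and `11`. -/
def sumTable (a : ℕ) (e : Exp) : Prog :=
  forRange 10 (forRange 11 (sumTo a (scalar 10) (scalar 11) e))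

theorem Achieves.sumTable (hs : s.Ok n N) (hN : n ≤ N) {a : ℕ} {e : Exp}
    (ha : a ≠ 0 ∧ a ≠ 10 ∧ a ≠ 11 ∧ a ≠ 12)
    (he : (Exp.add (.cell a (scalar 10) (scalar 11)) e).short = true)
    {f : Fin n → Fin n → Fin n → ℤ} (hf : ∀ i j x, |f i j x| ≤ (1 : ℕ))
    (H : ∀ (i j x : Fin n) (s' : Mem), AgreesOff [a, 10, 11, 12] s s' →
      s' 10 0 0 = (i : ℕ) → s' 11 0 0 = (j : ℕ) → s' 12 0 0 = (x : ℕ) → e.val s' = f i j x) :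
    Achieves n N (sumTable a e) s 6062 3 fun s' => AgreesOff [a, 10, 11, 12] s s' ∧
      ∀ i j : Fin n, s' a (i : ℕ) (j : ℕ) = ∑ x, f i j x := by
  refine Achieves.fillTable (c := 6022) (d := 1) hs hN ha.2 fun i j s₁ hs₁ h1 h10 h11 => ?_
  refine Achieves.sumTo hs₁ hN ha.1 ha.2.2.2 rfl rfl he (fun z s₂ h2 => ⟨?_, ?_, fun x h12 => ?_⟩)
    ⟨h10, h11⟩ (F := 1) (fun x => hf i j x) (by omega)
  · rw [scalar_val, h2 10 (by norm_num)]; simp [Mem.store, ha.2.1.symm, h10]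
  · rw [scalar_val, h2 11 (by norm_num)]; simp [Mem.store, ha.2.2.1.symm, h11]
  · have h10' : s₂ 10 0 0 = (i : ℕ) := by
      rw [h2 10 (by norm_num)]; simp [Mem.store, ha.2.1.symm, h10]
    have h11' : s₂ 11 0 0 = (j : ℕ) := by
      rw [h2 11 (by norm_num)]; simp [Mem.store, ha.2.2.1.symm, h11]
    refine H i j x s₂ (fun b hb => ?_) h10' h11' h12
    rw [← h1 b hb]
    simp only [List.mem_cons, not_or] at hb
    rw [h2 b hb.2.2.2.1]
    ext; simp [Mem.store, hb]

/-- The negation of a truth value. -/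
def notE (e : Exp) : Exp := .sub (.const 1) e

/-- The truth value of an equation. -/
def eqE (e f : Exp) : Exp := isZero (.sub e f)

/-- The truth value of adjacency. -/
def adjE (u v : Exp) : Exp := .cell 1 u v

/-- The truth value of `Forced`. -/
def forcedE (v u : Exp) : Exp := .mul (adjE v u) (isZero (.cell 4 v u))

/-- The truth value of `Allowed`. -/
def allowedE (v u : Exp) : Exp := .mul (adjE v u) (isZero (.cell 5 v u))

/-- The truth value of `x < u`. -/
def ltE (x u : Exp) : Exp := .div (.add (.sub u (.add x (.const 1))) (scalar 0)) (scalar 0)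

/-- The truth value of `Precedes`. -/
def precedesE (v x u : Exp) : Exp :=
  .add (.mul (forcedE v x) (notE (forcedE v u)))
    (.mul (eqE (forcedE v x) (forcedE v u)) (ltE x u))

/-- The truth value of `Leaf`. -/
def leafE (v u : Exp) : Exp := .mul (allowedE v u) (isZero (.cell 6 v u))

/-- The coefficients of the linear equations. -/
def rowE (v u x : Exp) : Exp :=
  .add (.add
    (.mul (.mul (eqE u v) (notE (isZero (.cell 7 (.const 0) v)))) (.sub (eqE x v) (leafE v x)))
    (.mul (.mul (leafE v u) (notE (forcedE v u)))
      (.mul (.mul (notE (isZero (.cell 7 (.const 0) v)))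
        (notE (eqE (.cell 7 (.const 0) v) (.const 1)))) (eqE x u))))
    (.mul (.sub (allowedE v u) (leafE v u)) (.sub (eqE x u) (.mul (leafE v x) (adjE u x))))

theorem notE_val {e : Exp} {p : Prop} (h : e.val s = ind p) : (notE e).val s = ind (¬ p) := by
  rw [notE, Exp.val, h, ← one_sub_ind]; rfl

theorem isZero_val_ind {e : Exp} : (isZero e).val s = ind (e.val s = 0) := by
  rw [isZero_val, ite_eq_ind]

theorem mul_val_ind {e f : Exp} {p q : Prop} (h : e.val s = ind p) (h' : f.val s = ind q) :
    (Exp.mul e f).val s = ind (p ∧ q) := by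
  rw [Exp.val, h, h', ind_mul_ind]

theorem eqE_val {e f : Exp} : (eqE e f).val s = ind (e.val s = f.val s) := by
  rw [eqE, isZero_val_ind, Exp.val, sub_eq_zero]

theorem eqE_val_fin {e f : Exp} {i j : Fin n} (hi : e.val s = (i : ℕ)) (hj : f.val s = (j : ℕ)) :
    (eqE e f).val s = ind (i = j) := by
  rw [eqE_val, hi, hj, Nat.cast_inj, Fin.val_inj]

/-- The numerator `j - i - 1 + n` lies between `0` and `2n - 2`, and it reaches `n` exactly if `i <
j`. -/
theorem ltE_val {e f : Exp} {i j : Fin n} (hi : e.val s = (i : ℕ)) (hj : f.val s = (j : ℕ))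
    (hs : s 0 0 0 = n) : (ltE e f).val s = ind (i < j) := by
  simp only [ltE, Exp.val, hi, hj, scalar_val, hs]
  by_cases h : i < j
  · rw [ind_of h, Int.ediv_eq_iff_of_pos (by omega)]
    rw [Fin.lt_def] at h; omega
  · rw [ind_of_not h, Int.ediv_eq_iff_of_pos (by omega)]
    rw [Fin.lt_def] at h; omega

variable {G : SimpleGraph (Fin n)} {e f g : Exp} {v u x : Fin n}

/-- The adjacency matrix is in the array `1`. -/
def AdjTable (G : SimpleGraph (Fin n)) (s : Mem) : Prop :=
  ∀ u v : Fin n, s 1 (u : ℕ) (v : ℕ) = ind (G.Adj u v)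

/-- The zeros in the array `4` tell which neighbours are forced. -/
def ForcedTable (G : SimpleGraph (Fin n)) (s : Mem) : Prop :=
  ∀ v u : Fin n, s 4 (v : ℕ) (u : ℕ) = 0 ↔ ∀ y, ¬ (G.Adj u y ∧ ¬ G.Adj v y ∧ ¬ y = v)

/-- The zeros in the array `5` tell which neighbours are allowed. -/
def AllowedTable (G : SimpleGraph (Fin n)) (s : Mem) : Prop :=
  ∀ v u : Fin n, s 5 (v : ℕ) (u : ℕ) = 0 ↔ ∀ x, ¬ (G.Adj u x ∧ ¬ G.Adj v x ∧ ¬ x = v ∧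
    ∀ y, ¬ (G.Adj x y ∧ ¬ G.Adj u y ∧ ¬ y = u))

/-- The zeros in the array `6` tell which allowed neighbours are leaves. -/
def LeafTable (G : SimpleGraph (Fin n)) (s : Mem) : Prop :=
  ∀ v u : Fin n, s 6 (v : ℕ) (u : ℕ) = 0 ↔
    ∀ x, ¬ (Allowed G v x ∧ G.Adj u x ∧ ¬ Precedes G v u x)

/-- The numbers of leaves are in the array `7`. -/
def CardTable (G : SimpleGraph (Fin n)) (s : Mem) : Prop :=
  ∀ v : Fin n, s 7 0 (v : ℕ) = (leaves G v).card

theorem adjE_val (h1 : AdjTable G s) (he : e.val s = (v : ℕ)) (hf : f.val s = (u : ℕ)) :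
    (adjE e f).val s = ind (G.Adj v u) := by
  rw [adjE, Exp.val, he, hf, h1]

theorem forcedE_val (h1 : AdjTable G s) (h4 : ForcedTable G s) (he : e.val s = (v : ℕ))
    (hf : f.val s = (u : ℕ)) : (forcedE e f).val s = ind (Forced G v u) := by
  rw [forcedE, mul_val_ind (adjE_val h1 he hf) isZero_val_ind, Exp.val, he, hf, h4]
  refine ind_congr (and_congr_right fun _ => forall_congr' fun x => ?_)
  tauto

theorem allowedE_val (h1 : AdjTable G s) (h5 : AllowedTable G s) (he : e.val s = (v : ℕ))
    (hf : f.val s = (u : ℕ)) : (allowedE e f).val s = ind (Allowed G v u) := by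
  rw [allowedE, mul_val_ind (adjE_val h1 he hf) isZero_val_ind, Exp.val, he, hf, h5]
  refine ind_congr (and_congr_right fun _ => forall_congr' fun x => ?_)
  rw [not_and, not_and, not_and, not_forall]
  have : (∃ y, ¬¬(G.Adj x y ∧ ¬G.Adj u y ∧ ¬y = u)) ↔ ∃ y, G.Adj x y ∧ y ≠ u ∧ ¬G.Adj u y :=
    exists_congr fun y => by tauto
  rw [this]
  tauto

theorem precedesE_val (hs : s 0 0 0 = n) (h1 : AdjTable G s) (h4 : ForcedTable G s)
    (he : e.val s = (v : ℕ)) (hf : f.val s = (x : ℕ)) (hg : g.val s = (u : ℕ)) :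
    (precedesE e f g).val s = ind (Precedes G v x u) := by
  have hx := forcedE_val h1 h4 he hf
  have hu := forcedE_val h1 h4 he hg
  rw [precedesE, Exp.val, mul_val_ind hx (notE_val hu), mul_val_ind eqE_val (ltE_val hf hg hs),
    hx, hu, Precedes]
  by_cases k1 : Forced G v x <;> by_cases k2 : Forced G v u <;> by_cases k3 : x < u <;>
    simp [ind, k1, k2, k3]

theorem leafE_val (h1 : AdjTable G s) (h5 : AllowedTable G s) (h6 : LeafTable G s)
    (he : e.val s = (v : ℕ)) (hf : f.val s = (u : ℕ)) : (leafE e f).val s = ind (Leaf G v u) := by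
  rw [leafE, mul_val_ind (allowedE_val h1 h5 he hf) isZero_val_ind, Exp.val, he, hf, h6]
  refine ind_congr (and_congr_right fun _ => forall_congr' fun x => ?_)
  rw [not_and, not_and, not_not]

/-- All tables that are needed for the coefficients of the linear equations. -/
structure Tables (G : SimpleGraph (Fin n)) (s : Mem) : Prop where
  adj : AdjTable G s
  forced : ForcedTable G s
  allowed : AllowedTable G s
  leaf : LeafTable G s
  card : CardTable G s

theorem Tables.congr {s' : Mem} (h : Tables G s) (h' : ∀ a ∈ [1, 4, 5, 6, 7], s' a = s a) :
    Tables G s' := by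
  simp only [List.mem_cons, List.not_mem_nil, or_false, forall_eq_or_imp, forall_eq] at h'
  obtain ⟨k1, k4, k5, k6, k7⟩ := h'
  obtain ⟨h1, h4, h5, h6, h7⟩ := h
  constructor
  · intro u v; rw [k1, h1]
  · intro u v; rw [k4, h4]
  · intro u v; rw [k5, h5]
  · intro u v; rw [k6, h6]
  · intro v; rw [k7, h7]

/-- The three summands belong to the cases of `row`, which exclude each other; the difference of the
values of `Allowed` and `Leaf` singles out the allowed non-leaves. -/
theorem rowE_val (h : Tables G s) (he : e.val s = (v : ℕ)) (hf : f.val s = (u : ℕ))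
    (hg : g.val s = (x : ℕ)) : (rowE e f g).val s = row G v u x := by
  obtain ⟨h1, h4, h5, h6, h7⟩ := h
  have hvu := leafE_val h1 h5 h6 he hf
  have hvx := leafE_val h1 h5 h6 he hg
  have hA := allowedE_val h1 h5 he hf
  have hF := notE_val (forcedE_val h1 h4 he hf)
  have h7v : (Exp.cell 7 (.const 0) e).val s = ((leaves G v).card : ℕ) := by
    rw [Exp.val, he, Exp.val, h7]
  have hc0 := notE_val (isZero_val_ind (e := Exp.cell 7 (.const 0) e) (s := s))
  have hc1 := notE_val (eqE_val (e := Exp.cell 7 (.const 0) e) (f := .const 1) (s := s))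
  rw [h7v] at hc0 hc1
  have hxu := eqE_val_fin (s := s) hg hf
  have hxv := eqE_val_fin (s := s) hg he
  have huv := eqE_val_fin (s := s) hf he
  have hadj := adjE_val h1 hf hg
  simp only [rowE, Exp.val] at *
  rw [hvu, hvx, hA, hF, hc0, hc1, hxu, hxv, huv, hadj]
  have hn : ¬ (((leaves G v).card : ℕ) : ℤ) = 0 ↔ (leaves G v).Nonempty := by
    rw [← Finset.card_ne_zero]; norm_cast
  have h2 : ind (¬ (((leaves G v).card : ℕ) : ℤ) = 0) * ind (¬ (((leaves G v).card : ℕ) : ℤ) = 1) =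
      ind (2 ≤ (leaves G v).card) := by
    rw [ind_mul_ind]; exact ind_congr (by omega)
  rw [h2, ind_congr hn, row]
  have hvv : u = v → ¬ Allowed G v u := by rintro rfl h; exact h.1.ne rfl
  have hll : Leaf G v u → Allowed G v u := fun h => h.1
  simp only [ite_eq_ind, mem_leaves]
  by_cases k1 : u = v
  · have k2 := hvv k1
    have k3 : ¬ Leaf G v u := fun h => k2 h.1
    rw [if_pos k1, ind_of k1, ind_of_not k2, ind_of_not k3]
    by_cases k4 : (leaves G v).Nonempty
    · rw [if_pos k4, ind_of k4]; ring
    · rw [if_neg k4, ind_of_not k4]; ring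
  rw [if_neg k1, ind_of_not k1]
  by_cases k2 : Leaf G v u
  · rw [if_pos (mem_leaves.2 k2), ind_of k2, ind_of (hll k2)]
    by_cases k3 : Forced G v u
    · rw [if_neg (by tauto), ind_of_not (not_not.2 k3)]; ring
    · rw [ind_of k3]
      by_cases k4 : 2 ≤ (leaves G v).card
      · rw [if_pos ⟨k3, k4⟩, ind_of k4]; ring
      · rw [if_neg (by tauto), ind_of_not k4]; ring
  rw [if_neg (fun h => k2 (mem_leaves.1 h)), ind_of_not k2]
  by_cases k3 : Allowed G v u
  · rw [if_pos k3, ind_of k3, ← ind_mul_ind (Leaf G v x)]; ring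
  · rw [if_neg k3, ind_of_not k3]; ring

end Tables

/-! ### Computing the tables in cubic time -/

section TablesProgram

variable {n N : ℕ} {s s' : Mem} {G : SimpleGraph (Fin n)}

/-- Compute the tables for the coefficients of the linear equations. -/
def tablesProg : Prog :=
  .seq (sumTable 4 (.mul (adjE (scalar 11) (scalar 12))
    (.mul (notE (adjE (scalar 10) (scalar 12))) (notE (eqE (scalar 12) (scalar 10))))))
  (.seq (sumTable 5 (.mul (adjE (scalar 11) (scalar 12)) (.mul (notE (adjE (scalar 10) (scalar 12)))
    (.mul (notE (eqE (scalar 12) (scalar 10))) (isZero (.cell 4 (scalar 11) (scalar 12)))))))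
  (.seq (sumTable 6 (.mul (allowedE (scalar 10) (scalar 12)) (.mul (adjE (scalar 11) (scalar 12))
    (notE (precedesE (scalar 10) (scalar 11) (scalar 12))))))
  (forRange 11 (sumTo 7 (.const 0) (scalar 11) (leafE (scalar 11) (scalar 12))))))

theorem AdjTable.congr (h : AdjTable G s) (h' : s' 1 = s 1) : AdjTable G s' := by
  intro u v; rw [h', h]

theorem ForcedTable.congr (h : ForcedTable G s) (h' : s' 4 = s 4) : ForcedTable G s' := by
  intro u v; rw [h', h]

theorem AllowedTable.congr (h : AllowedTable G s) (h' : s' 5 = s 5) : AllowedTable G s' := by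
  intro u v; rw [h', h]

theorem LeafTable.congr (h : LeafTable G s) (h' : s' 6 = s 6) : LeafTable G s' := by
  intro u v; rw [h', h]

/-- Each quantifier becomes a sum that is tested for zero. The entry `(v, u)` of array `4` counts
`N(u) \ N[v]`; its entry `(u, x)` then answers the inner quantifier of `Allowed`, so that no sum is
nested in another one. -/
theorem Achieves.tablesProg (hs : s.Ok n N) (hN : n ≤ N) (h1 : AdjTable G s) :
    Achieves n N tablesProg s 30000 3 fun s' =>
      AgreesOff [4, 5, 6, 7, 10, 11, 12] s s' ∧ Tables G s' := by
  refine (Achieves.seq (c₁ := 6062) (c₂ := 20000) ?_).mono (by norm_num) le_rfl fun _ _ h => h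
  refine (Achieves.sumTable hs hN (by norm_num) rfl
    (f := fun v u y => ind (G.Adj u y ∧ ¬ G.Adj v y ∧ ¬ y = v)) (fun _ _ _ => abs_ind_le _)
    fun v u y s' h h10 h11 h12 => ?_).mono le_rfl le_rfl fun s₁ hs₁ ⟨ha₁, hf₁⟩ => ?_
  · have h1' := h1.congr (h 1 (by simp))
    exact mul_val_ind (adjE_val h1' h11 h12) (mul_val_ind (notE_val (adjE_val h1' h10 h12))
      (notE_val (eqE_val_fin h12 h10)))
  have h1₁ := h1.congr (ha₁ 1 (by simp))
  have h4₁ : ForcedTable G s₁ := fun v u => by rw [hf₁, sum_ind_eq_zero_iff]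
  refine (Achieves.seq (c₁ := 6062) (c₂ := 13000) ?_).mono (by norm_num) le_rfl fun _ _ h => h
  refine (Achieves.sumTable hs₁ hN (by norm_num) rfl
    (f := fun v u x => ind (G.Adj u x ∧ ¬ G.Adj v x ∧ ¬ x = v ∧
      ∀ y, ¬ (G.Adj x y ∧ ¬ G.Adj u y ∧ ¬ y = u))) (fun _ _ _ => abs_ind_le _)
    fun v u y s' h h10 h11 h12 => ?_).mono le_rfl le_rfl fun s₂ hs₂ ⟨ha₂, hf₂⟩ => ?_
  · have h1' := h1₁.congr (h 1 (by simp))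
    have h4' := h4₁.congr (h 4 (by simp))
    refine mul_val_ind (adjE_val h1' h11 h12) (mul_val_ind (notE_val (adjE_val h1' h10 h12))
      (mul_val_ind (notE_val (eqE_val_fin h12 h10)) ?_))
    rw [isZero_val_ind, Exp.val, scalar_val, scalar_val, h11, h12, h4']
  have h1₂ := h1₁.congr (ha₂ 1 (by simp))
  have h4₂ := h4₁.congr (ha₂ 4 (by simp))
  have h5₂ : AllowedTable G s₂ := fun v u => by rw [hf₂, sum_ind_eq_zero_iff]
  refine (Achieves.seq (c₁ := 6062) (c₂ := 6062) ?_).mono (by norm_num) le_rfl fun _ _ h => h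
  refine (Achieves.sumTable hs₂ hN (by norm_num) rfl
    (f := fun v u x => ind (Allowed G v x ∧ G.Adj u x ∧ ¬ Precedes G v u x))
    (fun _ _ _ => abs_ind_le _)
    fun v u y s' h h10 h11 h12 => ?_).mono le_rfl le_rfl fun s₃ hs₃ ⟨ha₃, hf₃⟩ => ?_
  · have h1' := h1₂.congr (h 1 (by simp))
    have h4' := h4₂.congr (h 4 (by simp))
    have h5' := h5₂.congr (h 5 (by simp))
    exact mul_val_ind (allowedE_val h1' h5' h10 h12) (mul_val_ind (adjE_val h1' h11 h12)
      (notE_val (precedesE_val (by rw [h 0 (by simp), hs₂.size_eq]) h1' h4' h10 h11 h12)))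
  have h1₃ := h1₂.congr (ha₃ 1 (by simp))
  have h4₃ := h4₂.congr (ha₃ 4 (by simp))
  have h5₃ := h5₂.congr (ha₃ 5 (by simp))
  have h6₃ : LeafTable G s₃ := fun v u => by rw [hf₃, sum_ind_eq_zero_iff]
  refine (Achieves.fillRow (c := 6022) (d := 1) hs₃ hN (a := 7) (by norm_num) (i' := 0)
    (f := fun v => ∑ u, ind (Leaf G v u)) fun v s₄ hs₄ h h11 => ?_).mono (by norm_num) (by norm_num)
    fun s₄ hs₄ ⟨ha₄, hf₄, _⟩ => ?_
  · refine Achieves.sumTo hs₄ hN (by norm_num) (by norm_num) rfl rfl rfl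
      (fun z s₅ h₅ => ⟨rfl, ?_, fun u h12 => ?_⟩)
      ⟨rfl, h11⟩ (F := 1) (fun x => abs_ind_le _) (by omega)
    · rw [scalar_val, h₅ 11 (by norm_num)]; simp [Mem.store, h11]
    · have e : ∀ b, b ≠ 7 → b ≠ 12 → s₅ b = s₄ b := by
        intro b hb hb'
        rw [h₅ b hb']; ext; simp [Mem.store, hb]
      refine leafE_val (h1₃.congr ?_) (h5₃.congr ?_) (h6₃.congr ?_) ?_ h12
      · rw [e 1 (by norm_num) (by norm_num), h 1 (by simp)]
      · rw [e 5 (by norm_num) (by norm_num), h 5 (by simp)]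
      · rw [e 6 (by norm_num) (by norm_num), h 6 (by simp)]
      · rw [scalar_val, e 11 (by norm_num) (by norm_num), h11]
  · refine ⟨fun b hb => ?_, h1₃.congr (ha₄ 1 (by simp)), h4₃.congr (ha₄ 4 (by simp)),
      h5₃.congr (ha₄ 5 (by simp)), h6₃.congr (ha₄ 6 (by simp)), fun v => ?_⟩
    · simp only [List.mem_cons, not_or] at hb
      rw [ha₄ b (by simp [hb]), ha₃ b (by simp [hb]), ha₂ b (by simp [hb]), ha₁ b (by simp [hb])]
    · have := hf₄ v
      rw [this, leaves, Finset.card_filter]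
      push_cast
      rfl

end TablesProgram

/-! ### One elimination step on the machine -/

section EliminationProgram

open Matrix

variable {n N : ℕ} {s s' : Mem} {G : SimpleGraph (Fin n)}

/-- The memory represents the state of the elimination after the equations in `C`. -/
def Represents (C : Set (Fin n → ℤ)) (M : Matrix (Fin n) (Fin n) ℤ) (P : Set (Fin n))
    (s : Mem) : Prop :=
  EliminationState C M P ∧ s 17 0 0 = M.det ∧
    (∀ x f : Fin n, s 15 (x : ℕ) (f : ℕ) = M.adjugate x f) ∧
    ∀ f : Fin n, s 18 0 (f : ℕ) = ind (f ∈ P)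

theorem Represents.congr {C : Set (Fin n → ℤ)} {M : Matrix (Fin n) (Fin n) ℤ} {P : Set (Fin n)}
    (h : Represents C M P s) (h15 : s' 15 = s 15) (h17 : s' 17 = s 17) (h18 : s' 18 = s 18) :
    Represents C M P s' := by
  unfold Represents; rwa [h15, h17, h18]

/-- The index of the pivot column. -/
def pivotE : Exp := .sub (scalar 14) (.const 1)

/-- The update of the adjugate, the determinant and the set of the pivot columns. -/
def updateProg : Prog :=
  .seq (forRange 10 (forRange 11 (.write 16 (scalar 10) (scalar 11)
    (.add (.mul (eqE (scalar 11) pivotE) (.cell 15 (scalar 10) pivotE))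
      (.mul (notE (eqE (scalar 11) pivotE)) (.div (.sub
        (.mul (.cell 9 (.const 0) pivotE) (.cell 15 (scalar 10) (scalar 11)))
        (.mul (.cell 9 (.const 0) (scalar 11)) (.cell 15 (scalar 10) pivotE))) (scalar 17)))))))
  (.seq (forRange 10 (forRange 11 (.write 15 (scalar 10) (scalar 11)
    (.cell 16 (scalar 10) (scalar 11)))))
  (.seq (.write 17 (.const 0) (.const 0) (.cell 9 (.const 0) pivotE))
    (.write 18 (.const 0) pivotE (.const 1))))

/-- Array `9` holds `c ᵥ* M.adjugate`, which supplies the multipliers and the new determinant.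
Column `f` of the adjugate consists of cofactors that do not involve row `f`, so it stays. -/
theorem Achieves.updateProg (hs : s.Ok n N) (hN : n ≤ N) (hN' : n.factorial ≤ N)
    {C : Set (Fin n → ℤ)} {M : Matrix (Fin n) (Fin n) ℤ} {P : Set (Fin n)}
    (h : Represents C M P s) {c : Fin n → ℤ} (hc : ∀ i, |c i| ≤ 1)
    (h9 : ∀ g : Fin n, s 9 0 (g : ℕ) = (c ᵥ* M.adjugate) g) {f : Fin n}
    (h14 : s 14 0 0 = (f : ℕ) + 1) (hf : f ∉ P) (hcf : (c ᵥ* M.adjugate) f ≠ 0) :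
    Achieves n N updateProg s 13000 2 fun s' =>
      AgreesOff [10, 11, 12, 15, 16, 17, 18] s s' ∧
      Represents (insert c C) (M.updateRow f c) (insert f P) s' := by
  obtain ⟨hE, h17, h15, h18⟩ := h
  have hE' := hE.insert_of_ne_zero hc hf hcf
  set M' := M.updateRow f c with hM'
  have hB : ∀ x g, |M'.adjugate x g| ≤ N := fun x g =>
    (hE'.abs_adjugate_le x g).trans (by rw [Fintype.card_fin]; exact_mod_cast hN')
  have hpf : ∀ s' : Mem, s' 14 = s 14 → pivotE.val s' = (f : ℕ) := by
    intro s' h'; simp [pivotE, Exp.val, h14, h']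
  refine (Achieves.seq (c₁ := 3041) (c₂ := 9200) ?_).mono (by norm_num) le_rfl fun _ _ h => h
  refine (Achieves.fillTable (a := 16) (c := 3001) (d := 0) (f := fun x g => M'.adjugate x g)
    hs hN (by norm_num)
    fun x g s₁ hs₁ h₁ h10 h11 => ?_).mono le_rfl le_rfl fun s₁ hs₁ ⟨ha₁, hf₁⟩ => ?_
  · have k9 : s₁ 9 = s 9 := h₁ 9 (by simp)
    have k15 : s₁ 15 = s 15 := h₁ 15 (by simp)
    have k17 : s₁ 17 = s 17 := h₁ 17 (by simp)
    have kp := hpf s₁ (h₁ 14 (by simp))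
    refine Achieves.write_updates hs₁ (by norm_num) rfl rfl rfl h10 h11 ?_ (hB x g)
    have kg : (scalar 11).val s₁ = (g : ℕ) := h11
    have heq := eqE_val_fin kg kp
    have hne := notE_val heq
    simp only [Exp.val] at heq hne ⊢
    rw [heq, hne]
    simp only [scalar_val, h10, h11, kp, k9, k15, k17, h9, h15, h17]
    by_cases hgf : g = f
    · rw [ind_of hgf, ind_of_not (not_not.2 hgf), hgf, hM', adjugate_updateRow_self]; ring
    · rw [ind_of hgf, ind_of_not hgf, ← det_mul_adjugate_updateRow M c hcf x g hgf,
        Int.mul_ediv_cancel_left _ hE.det_ne]; ring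
  refine (Achieves.seq (c₁ := 3041) (c₂ := 6100) ?_).mono (by norm_num) le_rfl fun _ _ h => h
  refine (Achieves.fillTable (a := 15) (c := 3001) (d := 0) (f := fun x g => M'.adjugate x g)
    hs₁ hN (by norm_num)
    fun x g s₂ hs₂ h₂ h10 h11 => ?_).mono le_rfl le_rfl fun s₂ hs₂ ⟨ha₂, hf₂⟩ => ?_
  · refine Achieves.write_updates hs₂ (by norm_num) rfl rfl rfl h10 h11 ?_ (hB x g)
    rw [Exp.val, scalar_val, scalar_val, h10, h11, h₂ 16 (by simp), hf₁]
  have k : ∀ b, b ∉ [10, 11, 12, 15, 16] → s₂ b = s b := by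
    intro b hb
    simp only [List.mem_cons, not_or] at hb
    rw [ha₂ b (by simp [hb]), ha₁ b (by simp [hb])]
  have kp := hpf s₂ (k 14 (by simp))
  have h9f : (Exp.cell 9 (.const 0) pivotE).val s₂ = M'.det := by
    rw [Exp.val, kp, k 9 (by simp), det_updateRow_eq_vecMul_adjugate, ← h9]; rfl
  have hdet : |M'.det| ≤ N := by
    refine (abs_det_le hE'.bound).trans ?_
    rw [Fintype.card_fin]; exact_mod_cast hN'
  refine (Achieves.seq (c₁ := 3001) (c₂ := 3001) ?_).mono (by norm_num) le_rfl fun _ _ h => h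
  refine (Achieves.write_updates hs₂ (by norm_num) rfl rfl rfl rfl rfl h9f hdet).mono le_rfl
    (by norm_num) fun s₃ hs₃ hu₃ => ?_
  have k3 : ∀ b, b ∉ [12, 17] → s₃ b = s₂ b := by
    intro b hb
    simp only [List.mem_cons, not_or] at hb
    rw [hu₃ b (by simp [hb])]; ext; simp [Mem.store, hb]
  have kp3 := hpf s₃ (by rw [k3 14 (by simp), k 14 (by simp)])
  refine (Achieves.write_updates hs₃ (by norm_num) rfl rfl rfl rfl kp3 rfl ?_).mono le_rfl
    (by norm_num) fun s₄ hs₄ hu₄ => ?_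
  · have := f.2
    simp only [Exp.val, abs_one]
    omega
  have k4 : ∀ b, b ∉ [12, 18] → s₄ b = s₃ b := by
    intro b hb
    simp only [List.mem_cons, not_or] at hb
    rw [hu₄ b (by simp [hb])]; ext; simp [Mem.store, hb]
  refine ⟨fun b hb => ?_, hE', ?_, fun x g => ?_, fun g => ?_⟩
  · simp only [List.mem_cons, not_or] at hb
    rw [k4 b (by simp [hb]), k3 b (by simp [hb]), k b (by simp [hb])]
  · rw [k4 17 (by simp), hu₃ 17 (by norm_num)]
    simp [Mem.store, Exp.val]
  · rw [k4 15 (by simp), k3 15 (by simp), hf₂]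
  · rw [hu₄ 18 (by norm_num)]
    simp only [Mem.store, Exp.val, true_and, Nat.cast_inj, Fin.val_inj]
    split_ifs with hg
    · rw [ind_of (by simp [hg])]
    · rw [k3 18 (by simp), k 18 (by simp), h18]
      exact ind_congr (by simp [hg])

/-- Process the equation that is given by the scalar variables `13` and `19`. -/
def stepProg : Prog :=
  .seq (forRange 11 (.write 8 (.const 0) (scalar 11) (rowE (scalar 13) (scalar 19) (scalar 11))))
  (.seq (forRange 11 (sumTo 9 (.const 0) (scalar 11)
    (.mul (.cell 8 (.const 0) (scalar 12)) (.cell 15 (scalar 12) (scalar 11)))))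
  (.seq (.write 14 (.const 0) (.const 0) (.const 0))
  (.seq (forRange 11 (.branch
    (.mul (isZero (.cell 18 (.const 0) (scalar 11)))
      (notE (isZero (.cell 9 (.const 0) (scalar 11)))))
    (.write 14 (.const 0) (.const 0) (.add (scalar 11) (.const 1))) .skip))
  (.branch (scalar 14) updateProg .skip))))

theorem Achieves.stepProg (hs : s.Ok n N) (hN : n ≤ N) (hN' : n * n.factorial + 1 ≤ N)
    (hT : Tables G s) {v u : Fin n} (h13 : s 13 0 0 = (v : ℕ)) (h19 : s 19 0 0 = (u : ℕ))
    {C : Set (Fin n → ℤ)} (h : ∃ M P, Represents C M P s) :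
    Achieves n N stepProg s 40000 2 fun s' =>
      AgreesOff [8, 9, 10, 11, 12, 14, 15, 16, 17, 18] s s' ∧
      ∃ M P, Represents (insert (row G v u) C) M P s' := by
  obtain ⟨M, P, hR⟩ := h
  obtain ⟨hE, h17, h15, h18⟩ := hR
  -- For `n = 0` the summand `1` in `hN'` pays for `0! = 1`.
  have hfac : n.factorial ≤ N := by
    rcases Nat.eq_zero_or_pos n with h0 | h0
    · subst h0; simpa using hN'
    · nlinarith
  have hrow : ∀ x, |row G v u x| ≤ 1 := abs_row_le G v u
  set r := row G v u ᵥ* M.adjugate with hr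
  refine (Achieves.seq (c₁ := 3021) (c₂ := 36000) ?_).mono (by norm_num) le_rfl fun _ _ h => h
  refine (Achieves.fillRow (a := 8) (c := 3001) (d := 0) (f := row G v u) (i' := 0)
    hs hN (by norm_num)
    fun x s₁ hs₁ h₁ h11 => ?_).mono le_rfl (by norm_num) fun s₁ hs₁ ⟨ha₁, hf₁, _⟩ => ?_
  · refine Achieves.write_updates hs₁ (by norm_num) rfl rfl rfl rfl h11 ?_
      ((hrow x).trans (by exact_mod_cast (by omega : 1 ≤ N)))
    refine rowE_val (hT.congr fun a ha => h₁ a ?_) ?_ ?_ h11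
    · simp only [List.mem_cons, List.not_mem_nil, or_false] at ha ⊢; omega
    · rw [scalar_val, h₁ 13 (by simp), h13]
    · rw [scalar_val, h₁ 19 (by simp), h19]
  refine (Achieves.seq (c₁ := 6042) (c₂ := 29000) ?_).mono (by norm_num) le_rfl fun _ _ h => h
  refine (Achieves.fillRow (a := 9) (c := 6022) (d := 1) (f := r) (i' := 0) hs₁ hN (by norm_num)
    fun g s₂ hs₂ h₂ h11 => ?_).mono le_rfl (by norm_num) fun s₂ hs₂ ⟨ha₂, hf₂, _⟩ => ?_
  -- The final value is at most `n!`, but the partial sums are only bounded by `n * n!`; hence the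
  -- form of `hN'`.
  · refine Achieves.sumTo hs₂ hN (by norm_num) (by norm_num) rfl rfl rfl
      (f := fun x => row G v u x * M.adjugate x g)
      (fun z s₃ h₃ => ⟨rfl, ?_, fun x h12 => ?_⟩)
      ⟨rfl, h11⟩ (F := n.factorial) (fun x => ?_) (by omega)
    · rw [scalar_val, h₃ 11 (by norm_num)]; simp [Mem.store, h11]
    · have e : ∀ b, b ≠ 9 → b ≠ 12 → s₃ b = s₂ b := by
        intro b hb hb'
        rw [h₃ b hb']; ext; simp [Mem.store, hb]
      simp only [Exp.val, scalar_val, h12]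
      rw [e 8 (by norm_num) (by norm_num), h₂ 8 (by simp), hf₁, e 11 (by norm_num) (by norm_num),
        h11,
        e 15 (by norm_num) (by norm_num), h₂ 15 (by simp), ha₁ 15 (by simp), h15]
    · rw [abs_mul]
      have h1 := hE.abs_adjugate_le x g
      rw [Fintype.card_fin] at h1
      calc _ ≤ 1 * (n.factorial : ℤ) := mul_le_mul (hrow x) h1 (abs_nonneg _) (by norm_num)
        _ = _ := one_mul _
  refine (Achieves.seq (c₁ := 3001) (c₂ := 25000) ?_).mono (by norm_num) le_rfl fun _ _ h => h
  refine (Achieves.write_updates hs₂ (by norm_num) rfl rfl rfl rfl rfl rfl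
    (by simp [Exp.val])).mono le_rfl (by norm_num) fun s₃ hs₃ hu₃ => ?_
  have k3 : ∀ b, b ∉ [8, 9, 11, 12, 14] → s₃ b = s b := by
    intro b hb
    simp only [List.mem_cons, not_or] at hb
    rw [hu₃ b (by simp [hb]), ← ha₁ b (by simp [hb]), ← ha₂ b (by simp [hb])]
    ext; simp [Mem.store, hb]
  have k39 : ∀ g : Fin n, s₃ 9 0 (g : ℕ) = r g := by
    intro g
    rw [hu₃ 9 (by norm_num), ← hf₂ g]; simp [Mem.store]
  refine (Achieves.seq (c₁ := 5000) (c₂ := 15000) ?_).mono (by norm_num) le_rfl fun _ _ h => h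
  -- The scan leaves `f + 1` in array `14` for the last usable pivot `f`; the shift by one keeps `0`
  -- free to mean that the equation is redundant.
  refine (Achieves.forRange (c := 4002) (d := 0) (Q := fun s' => AgreesOff [11, 12, 14] s₃ s' ∧
    ((s' 14 0 0 = 0 ∧ ∀ g : Fin n, g ∉ P → r g = 0) ∨
      ∃ f : Fin n, s' 14 0 0 = (f : ℕ) + 1 ∧ f ∉ P ∧ r f ≠ 0)) hs₃ hN (by norm_num)
    (fun m s' => AgreesOff [11, 12, 14] s₃ s' ∧
    ((s' 14 0 0 = 0 ∧ ∀ g : Fin n, g.val < m → g ∉ P → r g = 0) ∨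
      ∃ f : Fin n, s' 14 0 0 = (f : ℕ) + 1 ∧ f ∉ P ∧ r f ≠ 0)) ?_ ?_ ?_).mono (by norm_num)
      (by norm_num) fun s₄ hs₄ ⟨ha₄, hp₄⟩ => ?_
  · refine ⟨fun b hb => ?_, Or.inl ⟨?_, by simp⟩⟩
    · simp only [List.mem_cons, not_or] at hb
      ext; simp [Mem.store, hb]
    · simp only [Mem.store]
      rw [hu₃ 14 (by norm_num)]
      simp [Mem.store, Exp.val]
  · rintro g s₄ hs₄ h11 ⟨ha₄, hp₄⟩
    have hval : (Exp.mul (isZero (.cell 18 (.const 0) (scalar 11)))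
        (notE (isZero (.cell 9 (.const 0) (scalar 11))))).val s₄ = ind (g ∉ P ∧ r g ≠ 0) := by
      rw [mul_val_ind isZero_val_ind (notE_val isZero_val_ind)]
      refine ind_congr (and_congr ?_ ?_)
      · simp only [Exp.val, scalar_val, h11]
        rw [ha₄ 18 (by simp), k3 18 (by simp), h18]
        by_cases hg : g ∈ P <;> simp [ind, hg]
      · simp only [Exp.val, scalar_val, h11]
        rw [ha₄ 9 (by simp), k39]
    refine Achieves.branch (c := 3001) hs₄ rfl (fun hpos => ?_) fun hpos => ?_
    · rw [hval] at hpos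
      have hg : g ∉ P ∧ r g ≠ 0 := by
        by_contra hg; rw [ind_of_not hg] at hpos; exact lt_irrefl _ hpos
      have hv : (Exp.add (scalar 11) (.const 1)).val s₄ = (g : ℕ) + 1 := by
        simp [Exp.val, h11]
      refine (Achieves.write_updates hs₄ (by norm_num) rfl rfl rfl rfl rfl hv ?_).mono le_rfl le_rfl
        fun s₅ hs₅ hu₅ => ⟨?_, fun b hb => ?_, Or.inr ⟨g, ?_, hg⟩⟩
      · rw [abs_of_nonneg (by positivity)]; have := g.2; omega
      · rw [hu₅ 11 (by norm_num)]; simp [Mem.store, h11]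
      · rw [← ha₄ b hb]
        simp only [List.mem_cons, not_or] at hb
        have := hu₅ b (by simp [hb])
        ext k l
        simp [Mem.store, hb, this]
      · simp only [Mem.store]
        rw [hu₅ 14 (by norm_num)]
        simp [Mem.store, Exp.val]
    · rw [hval] at hpos
      have hg : ¬ (g ∉ P ∧ r g ≠ 0) := by
        intro hg; rw [ind_of hg] at hpos; exact hpos one_pos
      refine (Achieves.skip hs₄ (Q := fun s' => s' = s₄) rfl).mono (by norm_num) le_rfl ?_
      rintro s₅ - rfl
      refine ⟨h11, fun b hb => ?_, ?_⟩
      · rw [← ha₄ b hb]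
        simp only [List.mem_cons, not_or] at hb
        ext; simp [Mem.store, hb]
      · rcases hp₄ with ⟨hp, hz⟩ | hp
        · refine Or.inl ⟨by simp [Mem.store, hp], fun g' hg' hgP => ?_⟩
          rcases Nat.lt_succ_iff_lt_or_eq.1 hg' with hlt | heq
          · exact hz g' hlt hgP
          · obtain rfl : g' = g := Fin.ext heq
            by_contra hne
            exact hg ⟨hgP, hne⟩
        · exact Or.inr (by simpa [Mem.store] using hp)
  · rintro s' _ ⟨h1, h2⟩
    refine ⟨h1, h2.imp_left fun h => ⟨h.1, fun g => h.2 g g.2⟩⟩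
  have k4 : ∀ b, b ∉ [8, 9, 11, 12, 14] → s₄ b = s b := by
    intro b hb
    rw [← k3 b hb]
    simp only [List.mem_cons, not_or] at hb
    exact ha₄ b (by simp [hb])
  have hR₄ : Represents C M P s₄ :=
    Represents.congr ⟨hE, h17, h15, h18⟩ (k4 15 (by simp)) (k4 17 (by simp)) (k4 18 (by simp))
  refine (Achieves.branch (c := 13000) hs₄ rfl (fun hpos => ?_) fun hpos => ?_).mono (by norm_num)
    le_rfl fun _ _ h => h
  · obtain ⟨hp, -⟩ | ⟨f, hp, hf, hrf⟩ := hp₄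
    · rw [scalar_val, hp] at hpos; exact (lt_irrefl _ hpos).elim
    · refine (Achieves.updateProg hs₄ hN hfac hR₄ hrow (fun g => ?_) hp hf hrf).mono le_rfl le_rfl
        fun s₅ hs₅ ⟨ha₅, hR₅⟩ => ⟨fun b hb => ?_, _, _, hR₅⟩
      · rw [ha₄ 9 (by simp), k39]
      · simp only [List.mem_cons, not_or] at hb
        rw [ha₅ b (by simp [hb]), k4 b (by simp [hb])]
  · refine (Achieves.skip hs₄ (Q := fun s' => s' = s₄) rfl).mono (by norm_num) (by norm_num) ?_
    rintro s₅ - rfl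
    obtain ⟨hp, hz⟩ | ⟨f, hp, -⟩ := hp₄
    · exact ⟨fun b hb => k4 b (by simp only [List.mem_cons, not_or] at hb; simp [hb]), M, P,
        hE.insert_of_eq_zero hz, hR₄.2⟩
    · refine (hpos ?_).elim
      rw [scalar_val, hp]; positivity

end EliminationProgram

/-! ### The complete program and its output -/

section MainProgram

open Matrix

variable {n N : ℕ} {s s' : Mem} {G : SimpleGraph (Fin n)}

/-- Start the elimination with the identity matrix. -/
def initProg : Prog :=
  .seq (forRange 10 (forRange 11 (.write 15 (scalar 10) (scalar 11) (eqE (scalar 10) (scalar 11)))))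
    (.write 17 (.const 0) (.const 0) (.const 1))

theorem Achieves.initProg (hs : s.Ok n N) (hN : n ≤ N) (hN' : 1 ≤ N)
    (h18 : ∀ f : Fin n, s 18 0 (f : ℕ) = 0) :
    Achieves n N initProg s 6100 2 fun s' => AgreesOff [10, 11, 12, 15, 17] s s' ∧
      ∃ M P, Represents (∅ : Set (Fin n → ℤ)) M P s' := by
  refine (Achieves.seq (c₁ := 3041) (c₂ := 3001) ?_).mono (by norm_num) le_rfl fun _ _ h => h
  refine (Achieves.fillTable (a := 15) (c := 3001) (d := 0) (f := fun x g => ind (x = g)) hs hN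
    (by norm_num) fun x g s₁ hs₁ h₁ h10 h11 => ?_).mono le_rfl le_rfl fun s₁ hs₁ ⟨ha₁, hf₁⟩ => ?_
  · exact Achieves.write_updates hs₁ (by norm_num) rfl rfl rfl h10 h11 (eqE_val_fin h10 h11)
      ((abs_ind_le _).trans (by exact_mod_cast hN'))
  refine (Achieves.write_updates hs₁ (by norm_num) rfl rfl rfl rfl rfl rfl
    (by simpa [Exp.val] using hN')).mono le_rfl (by norm_num) fun s₂ hs₂ hu₂ => ?_
  have k : ∀ b, b ∉ [12, 17] → s₂ b = s₁ b := by
    intro b hb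
    simp only [List.mem_cons, not_or] at hb
    rw [hu₂ b (by simp [hb])]; ext; simp [Mem.store, hb]
  refine ⟨fun b hb => ?_, 1, ∅, EliminationState.init, ?_, fun x f => ?_, fun f => ?_⟩
  · simp only [List.mem_cons, not_or] at hb
    rw [k b (by simp [hb]), ha₁ b (by simp [hb])]
  · rw [hu₂ 17 (by norm_num)]; simp [Mem.store, Exp.val]
  · rw [k 15 (by simp), hf₁, adjugate_one, one_apply, ite_eq_ind]
  · rw [k 18 (by simp), ha₁ 18 (by simp), h18, ind_of_not (by simp)]

/-- Process all equations. -/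
def equationsProg : Prog := forRange 13 (forRange 19 stepProg)

/-- There are `n²` equations at `O(n²)` steps each, which dominates the running time. The invariant
describes the pairs `(v, u)` handled so far in lexicographic order. -/
theorem Achieves.equationsProg (hs : s.Ok n N) (hN : n ≤ N) (hN' : n * n.factorial + 1 ≤ N)
    (hT : Tables G s) (h : ∃ M P, Represents (∅ : Set (Fin n → ℤ)) M P s) :
    Achieves n N equationsProg s 40040 4 fun s' =>
      ∃ M P, Represents {c | ∃ v u, c = row G v u} M P s' := by
  have tstore : ∀ {s : Mem} {a : ℕ} {i j x : ℤ}, a ∉ [1, 4, 5, 6, 7] → Tables G s →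
      Tables G (s.store a i j x) := by
    intro s a i j x ha h
    refine h.congr fun b hb => ?_
    have : b ≠ a := by rintro rfl; exact ha hb
    ext; simp [Mem.store, this]
  have rstore : ∀ {s : Mem} {a : ℕ} {i j x : ℤ} {C : Set (Fin n → ℤ)}, a ∉ [15, 17, 18] →
      (∃ M P, Represents C M P s) → ∃ M P, Represents C M P (s.store a i j x) := by
    rintro s a i j x C ha ⟨M, P, h⟩
    simp only [List.mem_cons, not_or] at ha
    refine ⟨M, P, h.congr ?_ ?_ ?_⟩ <;> ext <;> simp [Mem.store, Ne.symm ha.1, Ne.symm ha.2.1,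
      Ne.symm ha.2.2.1]
  refine Achieves.forRange (c := 40020) (d := 3) hs hN (by norm_num) (fun m s' => Tables G s' ∧
    ∃ M P, Represents {c | ∃ v u, v.val < m ∧ c = row G v u} M P s') ?_ ?_ ?_
  · refine ⟨tstore (by simp) hT, rstore (by simp) ?_⟩
    simpa using h
  · rintro v s₁ hs₁ h13 ⟨hT₁, h₁⟩
    refine Achieves.forRange (c := 40000) (d := 2) hs₁ hN (by norm_num) (fun m s' =>
      s' 13 0 0 = (v : ℕ) ∧ Tables G s' ∧ ∃ M P, Represents
        {c | ∃ v' u, (v'.val < v.val ∨ v' = v ∧ u.val < m) ∧ c = row G v' u} M P s') ?_ ?_ ?_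
    · refine ⟨by simp [Mem.store, h13], tstore (by simp) hT₁, rstore (by simp) ?_⟩
      simpa using h₁
    · rintro u s₂ hs₂ h19 ⟨h13', hT₂, h₂⟩
      refine (Achieves.stepProg hs₂ hN hN' hT₂ h13' h19 h₂).mono le_rfl le_rfl
        fun s₃ hs₃ ⟨ha₃, h₃⟩ => ⟨?_, ?_, tstore (by simp) (hT₂.congr fun a ha => ha₃ a ?_),
          rstore (by simp) ?_⟩
      · rw [ha₃ 19 (by simp), h19]
      · simp only [Mem.store]
        rw [ha₃ 13 (by simp), h13']; simp
      · simp only [List.mem_cons, List.not_mem_nil, or_false] at ha ⊢; omega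
      · convert h₃ using 5
        ext c
        simp only [Set.mem_ofPred_eq, Set.mem_insert_iff]
        constructor
        · rintro ⟨v', u', h | ⟨rfl, h⟩, rfl⟩
          · exact Or.inr ⟨v', u', Or.inl h, rfl⟩
          · rcases Nat.lt_succ_iff_lt_or_eq.1 h with h | h
            · exact Or.inr ⟨v', u', Or.inr ⟨rfl, h⟩, rfl⟩
            · rw [Fin.ext h]; exact Or.inl rfl
        · rintro (rfl | ⟨v', u', h | ⟨rfl, h⟩, rfl⟩)
          · exact ⟨v, u, Or.inr ⟨rfl, Nat.lt_succ_self _⟩, rfl⟩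
          · exact ⟨v', u', Or.inl h, rfl⟩
          · exact ⟨v', u', Or.inr ⟨rfl, by omega⟩, rfl⟩
    · rintro s₂ hs₂ ⟨h13', hT₂, h₂⟩
      refine ⟨h13', tstore (by simp) hT₂, rstore (by simp) ?_⟩
      convert h₂ using 5
      ext c
      simp only [Set.mem_ofPred_eq]
      refine exists_congr fun v' => exists_congr fun u => and_congr_left fun _ => ?_
      have := u.2
      rw [Fin.ext_iff]; omega
  · rintro s' _ ⟨-, h'⟩
    convert h' using 5
    ext c
    simp

/-- Copy the columns of the adjugate that belong to no pivot to the output. -/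
def outputProg : Prog :=
  .seq (.write 2 (.const 0) (.const 0) (.const 0))
  (forRange 19 (.seq
    (forRange 11 (.write 3 (scalar 2) (scalar 11) (.cell 15 (scalar 11) (scalar 19))))
    (.write 2 (.const 0) (.const 0) (.add (scalar 2) (isZero (.cell 18 (.const 0) (scalar 19)))))))

/-- Every column is copied to the next output row, but the row counter advances only for free
columns. A pivot column is therefore overwritten or left in a row beyond the announced number. -/
theorem Achieves.outputProg (hs : s.Ok n N) (hN : n ≤ N) :
    Achieves n N outputProg s 9200 2 fun s' =>
      s' 2 0 0 = (Nat.count (fun k : ℕ => s 18 0 k = 0) n : ℕ) ∧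
      ∀ f : Fin n, s 18 0 (f : ℕ) = 0 → ∀ x : Fin n,
        s' 3 (Nat.count (fun k : ℕ => s 18 0 k = 0) f : ℕ) (x : ℕ) = s 15 (x : ℕ) (f : ℕ) := by
  set p : ℕ → Prop := fun k : ℕ => s 18 0 k = 0 with hp
  refine (Achieves.seq (c₁ := 3001) (c₂ := 6100) ?_).mono (by norm_num) le_rfl fun _ _ h => h
  refine (Achieves.write_updates hs (by norm_num) rfl rfl rfl rfl rfl rfl
    (by simp [Exp.val])).mono le_rfl (by norm_num) fun s₁ hs₁ hu₁ => ?_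
  have k1 : ∀ b, b ∉ [2, 12] → s₁ b = s b := by
    intro b hb
    simp only [List.mem_cons, not_or] at hb
    rw [hu₁ b (by simp [hb])]; ext; simp [Mem.store, hb]
  refine (Achieves.forRange (c := 6050) (d := 1) hs₁ hN (by norm_num) (fun m s' =>
    s' 18 = s 18 ∧ s' 15 = s 15 ∧ s' 2 0 0 = (Nat.count p m : ℕ) ∧
      ∀ f : Fin n, f.val < m → p f → ∀ x : Fin n,
        s' 3 (Nat.count p f : ℕ) (x : ℕ) = s 15 (x : ℕ) (f : ℕ)) ?_ ?_ ?_).mono (by norm_num)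
      le_rfl fun _ _ h => h
  · refine ⟨?_, ?_, ?_, by simp⟩
    · rw [← k1 18 (by simp)]; ext; simp [Mem.store]
    · rw [← k1 15 (by simp)]; ext; simp [Mem.store]
    · simp only [Mem.store]
      rw [hu₁ 2 (by norm_num)]; simp [Mem.store, Exp.val]
  · rintro f s₂ hs₂ h19 ⟨h18, h15, h2, h3⟩
    refine (Achieves.seq (c₁ := 3021) (c₂ := 3001) ?_).mono (by norm_num) le_rfl fun _ _ h => h
    refine (Achieves.fillRow (a := 3) (c := 3001) (d := 0) (i' := (Nat.count p f : ℕ))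
      (f := fun x => s 15 (x : ℕ) (f : ℕ)) hs₂ hN (by norm_num)
      fun x s₃ hs₃ h₃ h11 => ?_).mono le_rfl le_rfl fun s₃ hs₃ ⟨ha₃, hf₃, hn₃⟩ => ?_
    · refine Achieves.write_updates hs₃ (by norm_num) rfl rfl rfl ?_ h11 ?_ (hs.abs_le _ _ _)
      · rw [scalar_val, h₃ 2 (by simp), h2]
      · rw [Exp.val, scalar_val, scalar_val, h11, h₃ 19 (by simp), h19, h₃ 15 (by simp), h15]
    have hv : (Exp.add (scalar 2) (isZero (.cell 18 (.const 0) (scalar 19)))).val s₃ =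
        (Nat.count p (f + 1) : ℕ) := by
      have e : (Exp.cell 18 (.const 0) (scalar 19)).val s₃ = s 18 0 (f : ℕ) := by
        rw [Exp.val, scalar_val, ha₃ 19 (by simp), h19, ha₃ 18 (by simp), h18]; rfl
      rw [Exp.val, isZero_val, e, scalar_val, ha₃ 2 (by simp), h2, Nat.count_succ]
      push_cast
      rfl
    refine (Achieves.write_updates hs₃ (by norm_num) rfl rfl rfl rfl rfl hv ?_).mono le_rfl
      (by norm_num) fun s₄ hs₄ hu₄ => ?_
    · rw [abs_of_nonneg (by positivity)]
      have := Nat.count_le (p := p) (n := f + 1)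
      have := f.2
      omega
    have k4 : ∀ b, b ∉ [2, 12] → s₄ b = s₃ b := by
      intro b hb
      simp only [List.mem_cons, not_or] at hb
      rw [hu₄ b (by simp [hb])]; ext; simp [Mem.store, hb]
    refine ⟨?_, ?_, ?_, ?_, fun g hg hpg x => ?_⟩
    · rw [k4 19 (by simp), ha₃ 19 (by simp), h19]
    · rw [← h18, ← ha₃ 18 (by simp), ← k4 18 (by simp)]; ext; simp [Mem.store]
    · rw [← h15, ← ha₃ 15 (by simp), ← k4 15 (by simp)]; ext; simp [Mem.store]
    · simp only [Mem.store]
      rw [hu₄ 2 (by norm_num)]; simp [Mem.store, Exp.val]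
    · have e : ∀ i j, (s₄.store 19 0 0 ((f : ℕ) + 1)) 3 i j = s₃ 3 i j := by
        intro i j
        rw [← k4 3 (by simp)]; simp [Mem.store]
      rw [e]
      by_cases hgf : g = f
      · subst hgf; exact hf₃ x
      · have hlt : g.val < f.val := by rw [Fin.ext_iff] at hgf; omega
        -- The earlier column `g` is free, so its output row has a strictly smaller index and is not
        -- touched.
        rw [hn₃, h3 g hlt hpg x]
        have := Nat.count_strict_mono hpg hlt
        omega
  · rintro s' _ ⟨-, -, h2, h3⟩
    exact ⟨h2, fun f hf x => h3 f f.2 hf x⟩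

theorem holdsBasis_of_count {M : Matrix (Fin n) (Fin n) ℤ} {P : Set (Fin n)}
    {C : Set (Fin n → ℤ)} (h : Represents C M P s)
    (h2 : s' 2 0 0 = (Nat.count (fun k : ℕ => s 18 0 k = 0) n : ℕ))
    (h3 : ∀ f : Fin n, s 18 0 (f : ℕ) = 0 → ∀ x : Fin n,
      s' 3 (Nat.count (fun k : ℕ => s 18 0 k = 0) f : ℕ) (x : ℕ) = s 15 (x : ℕ) (f : ℕ))
    {L : Submodule ℝ (Fin n → ℝ)} (hL : ∀ w, w ∈ L ↔ ∀ c ∈ C, ∑ x, (c x : ℝ) * w x = 0) :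
    HoldsBasis s' L := by
  obtain ⟨hE, -, h15, h18⟩ := h
  set p : ℕ → Prop := fun k : ℕ => s 18 0 k = 0 with hp
  have hpP : ∀ f : Fin n, p f ↔ f ∉ P := by
    intro f
    rw [hp]; simp only [h18]
    by_cases hf : f ∈ P <;> simp [ind, hf]
  -- `Nat.nth` inverts the counting and so recovers the free column stored in output row `i`.
  have hσ : ∀ i : Fin (Nat.count p n), ∃ f : Fin n, f ∉ P ∧ Nat.count p f = i := by
    intro i
    have hlt := Nat.nth_lt_of_lt_count i.2
    have hfin : ∀ hf : (Set.ofPred p).Finite, (i : ℕ) < hf.toFinset.card := fun hf =>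
      lt_of_lt_of_le i.2 (Nat.count_le_card hf n)
    exact ⟨⟨_, hlt⟩, (hpP _).1 (Nat.nth_mem _ hfin), Nat.count_nth hfin⟩
  choose σ hσP hσc using hσ
  have hrow : (fun (i : Fin (Nat.count p n)) (x : Fin n) =>
      (s' 3 ((i : ℕ) : ℤ) ((x : ℕ) : ℤ) : ℝ)) =
      fun i x => (M.adjugate x (σ i) : ℝ) := by
    ext i x
    rw [← h15, ← h3 (σ i) ((hpP _).2 (hσP i)) x, hσc]
  have hinj : Function.Injective σ := by
    intro i j hij
    rw [Fin.ext_iff, ← hσc, ← hσc, hij]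
  refine ⟨_, h2, ?_, ?_⟩
  · rw [hrow]
    exact hE.linearIndependent.comp σ hinj
  · rw [hrow]
    have hrange : Set.range (fun i x => (M.adjugate x (σ i) : ℝ)) =
        Set.range fun (f : ↥Pᶜ) (x : Fin n) => (M.adjugate x f : ℝ) := by
      ext w
      constructor
      · rintro ⟨i, rfl⟩; exact ⟨⟨σ i, hσP i⟩, rfl⟩
      · rintro ⟨⟨f, hf⟩, rfl⟩
        have hpf := (hpP f).2 hf
        refine ⟨⟨Nat.count p f, Nat.count_strict_mono hpf f.2⟩, ?_⟩
        have : σ ⟨Nat.count p f, Nat.count_strict_mono hpf f.2⟩ = f := by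
          apply Fin.ext
          exact Nat.count_injective ((hpP _).2 (hσP _)) hpf (hσc _)
        simp only [this]
    rw [hrange]
    apply SetLike.coe_injective
    rw [hE.span_eq]
    ext w
    exact (hL w).symm

/-- The program that computes a basis of the space of the weight functions with well-covered
graph. -/
def wellCoveredProg : Prog := .seq tablesProg (.seq initProg (.seq equationsProg outputProg))

theorem ok_inputMem (G : SimpleGraph (Fin n)) (hN : n ≤ N) (hN' : 1 ≤ N) :
    (inputMem G).Ok n N where
  size_eq := by simp [inputMem]
  abs_le a i j := by
    unfold inputMem
    split_ifs
    · simpa using hN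
    · simpa using hN'
    · simp

theorem adjTable_inputMem (G : SimpleGraph (Fin n)) : AdjTable G (inputMem G) := by
  intro u v
  have : (∃ u' v' : Fin n, ((u : ℕ) : ℤ) = (u' : ℕ) ∧ ((v : ℕ) : ℤ) = (v' : ℕ) ∧ G.Adj u' v') ↔
      G.Adj u v := by
    constructor
    · rintro ⟨u', v', h1, h2, h⟩
      obtain rfl : u = u' := Fin.ext (by exact_mod_cast h1)
      obtain rfl : v = v' := Fin.ext (by exact_mod_cast h2)
      exact h
    · exact fun h => ⟨u, v, rfl, rfl, h⟩
  simp only [inputMem, one_ne_zero, false_and, if_false, true_and, this, ite_eq_ind]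

theorem achieves_wellCoveredProg (hG : NoC4567 G) (hN : n ≤ N) (hN' : n * n.factorial + 1 ≤ N) :
    Achieves n N wellCoveredProg (inputMem G) 90000 4 fun s =>
      HoldsBasis s (wellCoveredSpace G) := by
  have hN1 : 1 ≤ N := by omega
  refine (Achieves.seq (c₁ := 30000) (c₂ := 60000) ?_).mono (by norm_num) le_rfl fun _ _ h => h
  refine (Achieves.tablesProg (ok_inputMem G hN hN1) hN (adjTable_inputMem G)).mono le_rfl
    (by norm_num) fun s₁ hs₁ ⟨ha₁, hT₁⟩ => ?_
  refine (Achieves.seq (c₁ := 6100) (c₂ := 50000) ?_).mono (by norm_num) le_rfl fun _ _ h => h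
  refine (Achieves.initProg hs₁ hN hN1 fun f => ?_).mono le_rfl (by norm_num)
    fun s₂ hs₂ ⟨ha₂, hR₂⟩ => ?_
  · rw [ha₁ 18 (by simp)]; simp [inputMem]
  refine (Achieves.seq (c₁ := 40040) (c₂ := 9200) ?_).mono (by norm_num) le_rfl fun _ _ h => h
  refine (Achieves.equationsProg hs₂ hN hN' (hT₁.congr fun a ha => ha₂ a ?_) hR₂).mono le_rfl
    le_rfl fun s₃ hs₃ ⟨M, P, hR₃⟩ => ?_
  · simp only [List.mem_cons, List.not_mem_nil, or_false] at ha ⊢; omega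
  refine (Achieves.outputProg hs₃ hN).mono le_rfl (by norm_num) fun s₄ hs₄ ⟨h2, h3⟩ =>
    holdsBasis_of_count hR₃ h2 h3 fun w => ?_
  rw [mem_wellCoveredSpace_iff_row hG]
  constructor
  · rintro h _ ⟨v, u, rfl⟩; exact h v u
  · exact fun h v u => h _ ⟨v, u, rfl⟩

/-- This rests on `n! ≤ n ^ n ≤ 2 ^ (n ^ 2)`. -/
theorem size_factorial_le (n : ℕ) : (n * n.factorial + n + 1).size ≤ n ^ 2 + 2 * n + 2 := by
  rw [Nat.size_le]
  have h1 : n < 2 ^ n := Nat.lt_two_pow_self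
  have h2 : n.factorial ≤ 2 ^ (n ^ 2) := by
    refine (Nat.factorial_le_pow n).trans ?_
    rw [pow_two, pow_mul]
    exact Nat.pow_le_pow_left h1.le n
  have h3 : 1 ≤ 2 ^ (n ^ 2) := Nat.one_le_two_pow
  rw [pow_add, pow_add, two_mul, pow_add]
  generalize 2 ^ n = a at *
  generalize 2 ^ (n ^ 2) = b at *
  have h4 : n * n.factorial ≤ a * b := Nat.mul_le_mul h1.le h2
  have h5 : a * b ≤ b * (a * a) := by
    rw [mul_comm a b]
    exact Nat.mul_le_mul_left _ (Nat.le_mul_of_pos_left _ (by omega))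
  have h6 : a ≤ a * b := Nat.le_mul_of_pos_right _ h3
  nlinarith

end MainProgram

end WWC

theorem theorem5 :
    (∀ (V : Type*) [Fintype V] [DecidableEq V] (G : SimpleGraph V), WWC.NoC4567 G →
      WWC.wellCoveredSpace G = ⨅ v : V, WWC.starSpace G v) ∧
    ∃ (p : WWC.Prog) (C : ℕ) (q : Polynomial ℕ),
      ∀ (n : ℕ) (G : SimpleGraph (Fin n)), WWC.NoC4567 G →
        ∃ (t b : ℕ) (s : WWC.Mem),
          WWC.Run p (WWC.inputMem G) t b s ∧
          t ≤ C * (n ^ 3 * (n + G.edgeSet.ncard) + 1) ∧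
          b ≤ q.eval n ∧
          WWC.HoldsBasis s (WWC.wellCoveredSpace G) := by
  refine ⟨fun V _ _ G hG => WWC.wellCoveredSpace_eq_iInf_starSpace hG, WWC.wellCoveredProg,
    90000 * 16, (Polynomial.X ^ 2 + 2 * Polynomial.X + 4) * 1000, fun n G hG => ?_⟩
  obtain ⟨t, b, s, hrun, ht, hb, -, hbasis⟩ :=
    -- This `N` bounds the partial sums, at most `n * n!`, as well as the loop counters, at most
    -- `n`.
    WWC.achieves_wellCoveredProg (N := n * n.factorial + n + 1) hG (by omega) (by omega)
  refine ⟨t, b, s, hrun, ht.trans ?_, hb.trans ?_, hbasis⟩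
  · rw [mul_assoc]
    refine Nat.mul_le_mul_left _ ?_
    -- The factor 16 comes from `n + 1 ≤ 2n` for `n ≥ 1`; the summand `1` settles `n = 0`.
    have h1 : (n + 1) ^ 4 ≤ 16 * (n ^ 4 + 1) := by
      rcases Nat.eq_zero_or_pos n with rfl | hn
      · norm_num
      · calc (n + 1) ^ 4 ≤ (2 * n) ^ 4 := Nat.pow_le_pow_left (by omega) 4
          _ ≤ _ := by ring_nf; omega
    refine h1.trans (Nat.mul_le_mul_left _ (Nat.add_le_add_right ?_ _))
    rw [pow_succ]
    exact Nat.mul_le_mul_left _ (Nat.le_add_right _ _)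
  · have := WWC.size_factorial_le n
    simp only [Polynomial.eval_mul, Polynomial.eval_add, Polynomial.eval_pow, Polynomial.eval_X,
      Polynomial.eval_ofNat]
    exact Nat.mul_le_mul_right _ (by omega)
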